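/- Let $G$ be a countable discrete (sofic) group with a sofic approximation $\sigma_k\colon G\to \mathrm{Sym}(d_k)$, $k\in\mathbb N$, $d_k\ge 1$; that is, writing $u_n(A)=|A|/n$ for $A\subseteq\{1,\dots,n\}$, we have $u_{d_k}(\{j:\sigma_k(gh)(j)=\sigma_k(g)\sigma_k(h)(j)\})\to 1$ for all $g,h\in G$ and $u_{d_k}(\{j:\sigma_k(g)(j)\neq\sigma_k(h)(j)\})\to 1$ for all $g\ne h$, as $k\to\infty$. Let $G$ act by continuous automorphisms on a compact metrizable group $X$, and let $\omega$ be a free ultrafilter on $\mathbb N$. Let $(Z_\omega,u_\omega)$ be the Loeb measure space: $Z_\omega$ is the ultraproduct of the sets $\{1,\dots,d_k\}$ along $\omega$, with the $\sigma$-algebra generated by the internal sets $\prod_{k\to\omega}A_k=\{[(j_k)_k]: j_k\in A_k \text{ for } \omega\text{-almost every } k\}$, and $u_\omega$ is the measure with $u_\omega(\prod_{k\to\omega}A_k)=\lim_{k\to\omega}|A_k|/d_k$. For a compact metrizable space $A$ let $\mathrm{Meas}(Z_\omega,A)$ be the set of measurable maps $Z_\omega\to A$ modulo almost everywhere equality.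 Let $\mathrm{Prob}(X)$ be the space of Borel probability measures on $X$ with the weak$^*$ topology, $\mathrm{Sub}(X)$ the space of closed subgroups of $X$ with the Hausdorff topology, and $m_Y\in\mathrm{Prob}(X)$ the Haar probability measure of $Y\in\mathrm{Sub}(X)$. Order $\mathrm{Meas}(Z_\omega,\mathrm{Sub}(X))$ by $Y_1\le Y_2$ iff $Y_1(z)\subseteq Y_2(z)$ for almost every $z$. A sequence $\nu_k\in\mathrm{Prob}(X^{d_k})$ is asymptotically supported on topological microstates as $k\to\omega$ if, for every $g\in G$, every open neighbourhood $U$ of the diagonal in $X\times X$ and every $\delta>0$, $$\lim_{k\to\omega}\nu_k\bigl(\{\phi\in X^{d_k}: u_{d_k}(\{j:(\phi(\sigma_k(g)(j)),g\phi(j))\in U\})>1-\delta\}\bigr)=1 .$$ Let $\mathcal L_\omega(G\curvearrowright X)\subseteq\mathrm{Meas}(Z_\omega,\mathrm{Prob}(X))$ be the set of classes of the maps $[(j_k)_k]\mapsto\lim_{k\to\omega}\nu_{k,j_k}$ (weak$^*$ limits), over all such sequences $(\nu_k)_k$, where $\nu_{k,j}$ is the $j$-th marginal of $\nu_k$. Let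 $\mathcal S_\omega(G\curvearrowright X)$ be the set of $Y\in\mathrm{Meas}(Z_\omega,\mathrm{Sub}(X))$ such that the map $z\mapsto m_{Y(z)}$ belongs to $\mathcal L_\omega(G\curvearrowright X)$, with the induced order. Then: (i) For every $\mu\in\mathcal L_\omega(G\curvearrowright X)$, the map $Y(z)=\overline{\langle\mathrm{supp}\,\mu(z)\rangle}$ (the closed subgroup generated by the support of $\mu(z)$) is measurable and defines an element of $\mathcal S_\omega(G\curvearrowright X)$. (ii) For all $Y_1,Y_2\in\mathcal S_\omega(G\curvearrowright X)$, the map $(Y_1\vee Y_2)(z)=\overline{\langle Y_1(z),Y_2(z)\rangle}$ is measurable and defines an element of $\mathcal S_\omega(G\curvearrowright X)$. (iii) $\mathrm{Meas}(Z_\omega,\mathrm{Sub}(X))$ and $\mathcal S_\omega(G\curvearrowright X)$ are complete join-lattices: in each of these partially ordered sets every family of elements, of any cardinality, has a least upper bound. -/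

import Mathlib

open MeasureTheory Filter Topology Set
open scoped ENNReal NNReal

noncomputable section

namespace SoficLattice

/-! ### Sofic approximations -/

/-- The uniform probability `u_n(A) = |A| / n` of a subset `A` of an `n`-element set. -/
def unif {n : ℕ} (A : Set (Fin n)) : ℝ := (A.ncard : ℝ) / (n : ℝ)

/-- A sofic approximation of `G`: maps `σ k : G → Sym(d k)`, not assumed to be homomorphisms,
that are asymptotically multiplicative and asymptotically free as `k → ∞`. -/
structure IsSoficApproximation {G : Type*} [Group G] {d : ℕ → ℕ}
    (σ : ∀ k, G → Equiv.Perm (Fin (d k))) : Prop where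
  multiplicative : ∀ g h : G,
    Tendsto (fun k => unif {j | σ k (g * h) j = σ k g (σ k h j)}) atTop (𝓝 1)
  free : ∀ g h : G, g ≠ h →
    Tendsto (fun k => unif {j | σ k g j ≠ σ k h j}) atTop (𝓝 1)

/-! ### The Loeb measure space -/

/-- The ultraproduct `Z_ω` of the finite sets `{1, …, d k}` along `ω`. -/
def LoebSpace (ω : Ultrafilter ℕ) (d : ℕ → ℕ) : Type :=
  (ω : Filter ℕ).Product (fun k => Fin (d k))

variable {ω : Ultrafilter ℕ} {d : ℕ → ℕ}

/-- The class `(j_k)_{k → ω}` of a sequence `(j_k)_k` in the ultraproduct. -/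
def LoebSpace.mk (ω : Ultrafilter ℕ) {d : ℕ → ℕ} (j : ∀ k, Fin (d k)) : LoebSpace ω d :=
  Quotient.mk (productSetoid (ω : Filter ℕ) (fun k => Fin (d k))) j

theorem LoebSpace.mk_eq_mk {j j' : ∀ k, Fin (d k)} :
    LoebSpace.mk ω j = LoebSpace.mk ω j' ↔ ∀ᶠ k in (ω : Filter ℕ), j k = j' k :=
  Quotient.eq (r := productSetoid (ω : Filter ℕ) (fun k => Fin (d k)))

theorem LoebSpace.exists_rep (z : LoebSpace ω d) : ∃ j, LoebSpace.mk ω j = z :=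
  Quotient.exists_rep z

/-- The internal set `∏_{k → ω} A_k`. -/
def internalSet (ω : Ultrafilter ℕ) {d : ℕ → ℕ} (A : ∀ k, Set (Fin (d k))) :
    Set (LoebSpace ω d) :=
  {z | ∃ j, LoebSpace.mk ω j = z ∧ ∀ᶠ k in (ω : Filter ℕ), j k ∈ A k}

theorem mk_mem_internalSet {A : ∀ k, Set (Fin (d k))} {j : ∀ k, Fin (d k)} :
    LoebSpace.mk ω j ∈ internalSet ω A ↔ ∀ᶠ k in (ω : Filter ℕ), j k ∈ A k := by
  refine ⟨?_, fun h => ⟨j, rfl, h⟩⟩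
  rintro ⟨j', hj', h⟩
  filter_upwards [LoebSpace.mk_eq_mk.1 hj', h] with k h1 h2
  exact h1 ▸ h2

/-- The Loeb `σ`-algebra: it is generated by the internal sets. -/
instance : MeasurableSpace (LoebSpace ω d) :=
  MeasurableSpace.generateFrom (range (internalSet ω (d := d)))

/-- The limit along `ω` of the uniform probabilities of the sets `A k`
(along an ultrafilter the upper limit is the limit). -/
def density (ω : Ultrafilter ℕ) {d : ℕ → ℕ} (A : ∀ k, Set (Fin (d k))) : ℝ≥0∞ :=
  limsup (fun k => ENNReal.ofReal (unif (A k))) (ω : Filter ℕ)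

theorem tendsto_density (A : ∀ k, Set (Fin (d k))) :
    Tendsto (fun k => ENNReal.ofReal (unif (A k))) (ω : Filter ℕ) (𝓝 (density ω A)) := by
  obtain ⟨a, -, ha⟩ := isCompact_univ.ultrafilter_le_nhds
    (ω.map (fun k => ENNReal.ofReal (unif (A k)))) (by simp)
  have ha' : Tendsto (fun k => ENNReal.ofReal (unif (A k))) (ω : Filter ℕ) (𝓝 a) := ha
  rw [density, ha'.limsup_eq]
  exact ha'

theorem density_le {A B : ∀ k, Set (Fin (d k))} (h : ∀ᶠ k in (ω : Filter ℕ), A k ⊆ B k) :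
    density ω A ≤ density ω B := by
  refine le_of_tendsto_of_tendsto (tendsto_density A) (tendsto_density B) ?_
  filter_upwards [h] with k hk
  exact ENNReal.ofReal_le_ofReal (div_le_div_of_nonneg_right
    (by exact_mod_cast ncard_le_ncard hk (toFinite _)) (Nat.cast_nonneg _))

theorem density_union_le (A B : ∀ k, Set (Fin (d k))) :
    density ω (fun k => A k ∪ B k) ≤ density ω A + density ω B := by
  refine le_of_tendsto_of_tendsto (tendsto_density _)
    ((tendsto_density A).add (tendsto_density B)) (Eventually.of_forall fun k => ?_)
  dsimp only
  rw [← ENNReal.ofReal_add (by unfold unif; positivity) (by unfold unif; positivity)]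
  refine ENNReal.ofReal_le_ofReal ?_
  unfold unif
  rw [← add_div]
  exact div_le_div_of_nonneg_right (by exact_mod_cast ncard_union_le _ _) (Nat.cast_nonneg _)

theorem density_inter_add_diff (A B : ∀ k, Set (Fin (d k))) :
    density ω (fun k => A k ∩ B k) + density ω (fun k => A k \ B k) = density ω A := by
  refine tendsto_nhds_unique ((tendsto_density _).add (tendsto_density _))
    ((tendsto_density A).congr fun k => ?_)
  rw [← ENNReal.ofReal_add (by unfold unif; positivity) (by unfold unif; positivity)]
  congr 1
  unfold unif
  rw [← add_div, ← ncard_inter_add_ncard_sdiff_eq_ncard (A k) (B k) (toFinite _)]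
  push_cast
  rfl

theorem internalSet_inter (A B : ∀ k, Set (Fin (d k))) :
    internalSet ω A ∩ internalSet ω B = internalSet ω (fun k => A k ∩ B k) := by
  ext z
  obtain ⟨j, rfl⟩ := z.exists_rep
  simp only [mem_inter_iff, mk_mem_internalSet, eventually_and]

theorem internalSet_diff (A B : ∀ k, Set (Fin (d k))) :
    internalSet ω A \ internalSet ω B = internalSet ω (fun k => A k \ B k) := by
  ext z
  obtain ⟨j, rfl⟩ := z.exists_rep
  simp only [Set.mem_sdiff, mk_mem_internalSet, eventually_and, Ultrafilter.eventually_not]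

/-- The set function sending an internal set to its limiting density, and any other set to `∞`. -/
def loebContent (ω : Ultrafilter ℕ) (d : ℕ → ℕ) (s : Set (LoebSpace ω d)) : ℝ≥0∞ :=
  ⨅ (A : ∀ k, Set (Fin (d k))) (_ : internalSet ω A = s), density ω A

theorem loebContent_internalSet_le (A : ∀ k, Set (Fin (d k))) :
    loebContent ω d (internalSet ω A) ≤ density ω A :=
  iInf₂_le_of_le A rfl le_rfl

theorem loebContent_empty : loebContent ω d ∅ = 0 := by
  refine le_antisymm (iInf₂_le_of_le (fun _ => ∅) ?_ ?_) bot_le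
  · ext z
    obtain ⟨j, rfl⟩ := z.exists_rep
    simp [mk_mem_internalSet, ω.neBot.ne]
  · simp [density, unif]

/-- The Loeb outer measure: the infimum of the total densities of countable covers by
internal sets. -/
def loebOuter (ω : Ultrafilter ℕ) (d : ℕ → ℕ) : OuterMeasure (LoebSpace ω d) :=
  OuterMeasure.ofFunction (loebContent ω d) loebContent_empty

theorem le_caratheodory :
    (inferInstance : MeasurableSpace (LoebSpace ω d)) ≤ (loebOuter ω d).caratheodory := by
  refine MeasurableSpace.generateFrom_le ?_
  rintro _ ⟨B, rfl⟩
  refine OuterMeasure.ofFunction_caratheodory fun t => ?_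
  refine le_iInf₂ fun A hA => ?_
  subst hA
  rw [← density_inter_add_diff A B]
  rw [internalSet_inter, internalSet_diff]
  exact add_le_add (loebContent_internalSet_le _) (loebContent_internalSet_le _)

/-- The Loeb measure `u_ω`. -/
def loebMeasure (ω : Ultrafilter ℕ) (d : ℕ → ℕ) : Measure (LoebSpace ω d) :=
  (loebOuter ω d).toMeasure le_caratheodory

theorem measurableSet_internalSet (A : ∀ k, Set (Fin (d k))) :
    MeasurableSet (internalSet ω A) :=
  MeasurableSpace.measurableSet_generateFrom ⟨A, rfl⟩

/-- Countable saturation, for covers by internal sets. -/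
theorem exists_finite_cover [∀ k, NeZero (d k)] (hω : (ω : Filter ℕ) ≤ cofinite)
    (A : ∀ k, Set (Fin (d k))) (B : ℕ → ∀ k, Set (Fin (d k)))
    (h : internalSet ω A ⊆ ⋃ n, internalSet ω (B n)) :
    ∃ n, ∀ᶠ k in (ω : Filter ℕ), A k ⊆ ⋃ i ∈ Finset.range n, B i k := by
  by_contra hcon
  rw [not_exists] at hcon
  let C : ℕ → ∀ k, Set (Fin (d k)) := fun n k => A k \ ⋃ i ∈ Finset.range n, B i k
  have hC : ∀ n, ∀ᶠ k in (ω : Filter ℕ), (C n k).Nonempty := fun n => by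
    filter_upwards [Ultrafilter.frequently_iff_eventually.1 (not_eventually.1 (hcon n))] with k hk
    exact sdiff_nonempty.2 hk
  have hanti : ∀ k m n, m ≤ n → C n k ⊆ C m k := fun k m n hmn =>
    sdiff_subset_sdiff_right (biUnion_subset_biUnion_left (fun i hi =>
      Finset.mem_coe.2 (Finset.range_mono hmn (Finset.mem_coe.1 hi))))
  have hj : ∀ k, ∃ x : Fin (d k), ∀ n ≤ k, (C n k).Nonempty → x ∈ C n k := fun k => by
    classical
    by_cases h0 : ∃ n ≤ k, (C n k).Nonempty
    · obtain ⟨n0, hn0, h0⟩ := h0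
      have hs := Nat.findGreatest_spec (P := fun n => (C n k).Nonempty) hn0 h0
      refine ⟨hs.some, fun n hn hne => ?_⟩
      exact hanti k n _ (Nat.le_findGreatest hn hne) hs.some_mem
    · push Not at h0
      exact ⟨0, fun n hn hne => absurd (h0 n hn) hne.ne_empty⟩
  choose j hj using hj
  have hmem : ∀ n, ∀ᶠ k in (ω : Filter ℕ), j k ∈ C n k := fun n => by
    have h1 : ∀ᶠ k in (ω : Filter ℕ), n ≤ k :=
      (hω.trans (Nat.cofinite_eq_atTop).le) (eventually_ge_atTop n)
    filter_upwards [h1, hC n] with k hk hne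
    exact hj k n hk hne
  have hA : LoebSpace.mk ω j ∈ internalSet ω A :=
    mk_mem_internalSet.2 ((hmem 0).mono fun k hk => hk.1)
  obtain ⟨n, hn⟩ := mem_iUnion.1 (h hA)
  have hn' := mk_mem_internalSet.1 hn
  obtain ⟨k, hk1, hk2⟩ := ((hmem (n + 1)).and hn').exists
  exact hk1.2 (mem_biUnion (Finset.mem_coe.2 (Finset.self_mem_range_succ n)) hk2)

/-- The Loeb measure of an internal set is the limit of the uniform probabilities. -/
theorem loebMeasure_internalSet [∀ k, NeZero (d k)] (hω : (ω : Filter ℕ) ≤ cofinite)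
    (A : ∀ k, Set (Fin (d k))) : loebMeasure ω d (internalSet ω A) = density ω A := by
  rw [loebMeasure, toMeasure_apply _ _ (measurableSet_internalSet A)]
  refine le_antisymm
    ((OuterMeasure.ofFunction_le _).trans (loebContent_internalSet_le A)) ?_
  rw [loebOuter, OuterMeasure.ofFunction_apply]
  refine le_iInf₂ fun t ht => ?_
  by_cases hint : ∀ n, ∃ B : ∀ k, Set (Fin (d k)), internalSet ω B = t n
  swap
  · push Not at hint
    obtain ⟨n, hn⟩ := hint
    have : loebContent ω d (t n) = ⊤ := by
      simp only [loebContent, iInf_eq_top]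
      exact fun B hB => absurd hB (hn B)
    exact le_top.trans (this.symm.le.trans (ENNReal.le_tsum n))
  refine ENNReal.le_of_forall_pos_le_add fun ε hε _ => ?_
  obtain ⟨ε', hε', hsum⟩ := ENNReal.exists_pos_sum_of_countable
    (ENNReal.coe_pos.2 hε).ne' ℕ
  have hB : ∀ n, ∃ B : ∀ k, Set (Fin (d k)), internalSet ω B = t n ∧
      density ω B ≤ loebContent ω d (t n) + ε' n := fun n => by
    by_cases htop : loebContent ω d (t n) = ⊤
    · obtain ⟨B, hB⟩ := hint n
      exact ⟨B, hB, by simp [htop]⟩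
    · have hlt : loebContent ω d (t n) < loebContent ω d (t n) + ε' n :=
        ENNReal.lt_add_right htop (ENNReal.coe_pos.2 (hε' n)).ne'
      conv_lhs at hlt => rw [loebContent]
      obtain ⟨B, hB⟩ := iInf_lt_iff.1 hlt
      obtain ⟨hB1, hB2⟩ := iInf_lt_iff.1 hB
      exact ⟨B, hB1, hB2.le⟩
  choose B hB1 hB2 using hB
  obtain ⟨n, hn⟩ := exists_finite_cover hω A B (ht.trans (by simp [hB1]))
  have hfin : ∀ n, density ω (fun k => ⋃ i ∈ Finset.range n, B i k) ≤
      ∑ i ∈ Finset.range n, density ω (B i) := fun n => by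
    induction n with
    | zero => simp [density, unif]
    | succ n ih =>
      have he : (fun k => ⋃ i ∈ Finset.range (n + 1), B i k) =
          fun k => (⋃ i ∈ Finset.range n, B i k) ∪ B n k := by
        funext k
        rw [Finset.range_add_one, Finset.set_biUnion_insert, union_comm]
      rw [he, Finset.sum_range_succ]
      exact (density_union_le _ _).trans (by gcongr)
  calc density ω A ≤ density ω (fun k => ⋃ i ∈ Finset.range n, B i k) := density_le hn
    _ ≤ ∑ i ∈ Finset.range n, density ω (B i) := hfin n
    _ ≤ ∑' i, density ω (B i) := ENNReal.sum_le_tsum _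
    _ ≤ ∑' i, (loebContent ω d (t i) + ε' i) := ENNReal.tsum_le_tsum hB2
    _ = ∑' i, loebContent ω d (t i) + ∑' i, (ε' i : ℝ≥0∞) := ENNReal.tsum_add
    _ ≤ _ := by gcongr

/-! ### Closed subgroups of a compact group -/

variable {X : Type*} [Group X] [TopologicalSpace X]

/-- A closed subgroup of a compact group, as a nonempty compact subset. -/
def toNonemptyCompacts [CompactSpace X] (Y : ClosedSubgroup X) :
    TopologicalSpace.NonemptyCompacts X :=
  ⟨⟨(Y : Set X), Y.isClosed'.isCompact⟩, ⟨1, Y.one_mem'⟩⟩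

/-- `Sub(X)` as a subspace of the hyperspace of nonempty closed subsets of `X`, with its
Hausdorff (that is, Vietoris) topology. -/
instance [CompactSpace X] : TopologicalSpace (ClosedSubgroup X) :=
  TopologicalSpace.induced toNonemptyCompacts inferInstance

/-- The closed subgroup generated by a set. -/
def closedSubgroupGen [IsTopologicalGroup X] (s : Set X) : ClosedSubgroup X :=
  ⟨(Subgroup.closure s).topologicalClosure, (Subgroup.closure s).isClosed_topologicalClosure⟩

section Haar

variable [IsTopologicalGroup X] [CompactSpace X] [MeasurableSpace X] [BorelSpace X]

/-- The Haar probability measure `m_Y` of a closed subgroup `Y`, as a measure on `X`. -/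
def haarProb (Y : ClosedSubgroup X) : ProbabilityMeasure X :=
  haveI : CompactSpace Y.toSubgroup := isCompact_iff_compactSpace.mp Y.isClosed'.isCompact
  haveI : IsProbabilityMeasure
      (Measure.haarMeasure (⊤ : TopologicalSpace.PositiveCompacts Y.toSubgroup)) :=
    ⟨Measure.haarMeasure_self (K₀ := (⊤ : TopologicalSpace.PositiveCompacts Y.toSubgroup))⟩
  ⟨(Measure.haarMeasure (⊤ : TopologicalSpace.PositiveCompacts Y.toSubgroup)).map Subtype.val,
    Measure.isProbabilityMeasure_map measurable_subtype_coe.aemeasurable⟩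

end Haar

/-! ### Generalized local weak-star limits -/

/-- The marginal on the coordinate `j` of a probability measure on `X^n`. -/
def marginal {X : Type*} [MeasurableSpace X] {n : ℕ} (ν : ProbabilityMeasure (Fin n → X))
    (j : Fin n) : ProbabilityMeasure X :=
  ν.map (measurable_pi_apply j).aemeasurable

/-- `Meas(Z_ω, A)`: measurable maps from the Loeb space to `A`, up to almost everywhere equality. -/
abbrev Meas (ω : Ultrafilter ℕ) (d : ℕ → ℕ) (A : Type*) [TopologicalSpace A] : Type _ :=
  LoebSpace ω d →ₘ[loebMeasure ω d] A

section Limits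

variable {G : Type*} (ω : Ultrafilter ℕ) {d : ℕ → ℕ} (σ : ∀ k, G → Equiv.Perm (Fin (d k)))
variable (X : Type*) [TopologicalSpace X] [MeasurableSpace X]

/-- `P_ω(G ↷ X)`: the sequences of probability measures on `X^{d k}` that are asymptotically
supported on topological microstates as `k → ω`. -/
def microstateMeasures [SMul G X] : Set (∀ k, ProbabilityMeasure (Fin (d k) → X)) :=
  {ν | ∀ (g : G) (U : Set (X × X)), IsOpen U → (∀ x, (x, x) ∈ U) → ∀ δ : ℝ, 0 < δ →
    Tendsto (fun k => ν k {φ | 1 - δ < unif {j | (φ (σ k g j), g • φ j) ∈ U}})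
      (ω : Filter ℕ) (𝓝 1)}

/-- `L_ω(G ↷ X)`: the classes of the maps `(j_k)_{k → ω} ↦ lim_{k → ω} (ν_k)_{j_k}`, the limits
being weak-star limits of marginals, for `(ν_k)_k` in `P_ω(G ↷ X)`. -/
def generalizedLimits [OpensMeasurableSpace X] [SMul G X] :
    Set (Meas ω d (ProbabilityMeasure X)) :=
  {μ | ∃ ν ∈ microstateMeasures ω σ X, ∀ᵐ z ∂(loebMeasure ω d),
    ∀ j : ∀ k, Fin (d k), LoebSpace.mk ω j = z →
      Tendsto (fun k => marginal (ν k) (j k)) (ω : Filter ℕ) (𝓝 (μ z))}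

/-- `S_ω(G ↷ X)`: the measurably varying closed subgroups `Y` whose Haar measures
`m_Y : z ↦ m_{Y(z)}` form an element of `L_ω(G ↷ X)`. -/
def limitSubgroups [Group X] [IsTopologicalGroup X] [CompactSpace X] [BorelSpace X] [SMul G X] :
    Set (Meas ω d (ClosedSubgroup X)) :=
  {Y | ∃ h : AEStronglyMeasurable (fun z => haarProb (Y z)) (loebMeasure ω d),
    AEEqFun.mk (fun z => haarProb (Y z)) h ∈ generalizedLimits ω σ X}

end Limits

/-- A complete join-lattice: a partially ordered set in which every family has a join. -/
def IsCompleteJoinLattice (P : Type*) [PartialOrder P] : Prop :=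
  ∀ s : Set P, ∃ b : P, IsLUB s b

end SoficLattice

end

open SoficLattice

open scoped BoundedContinuousFunction

namespace SoficLattice

set_option linter.unusedSectionVars false

noncomputable section

/-! The argument realizes joins of closed subgroups by operations on measures under which
generalized limits are stable. Three such operations suffice. Convolution is allowed because `G`
acts by automorphisms and multiplication is uniformly continuous, so the product of two approximate
microstates is an approximate microstate (`IsGeneralizedLimit.conv`). Finite averages are allowed
because the condition on the measures is affine (`IsGeneralizedLimit.average`). Almost everywhere
limits are allowed by a diagonal choice along `ω`, controlled by convergence in measure and
Borel–Cantelli (`exists_diagonal`, `IsGeneralizedLimit.of_tendsto`).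

By the Kawada–Itô theorem (`tendsto_average_convPow`), the averages of the convolution powers of
`μ(z)` converge to the Haar measure of the closed subgroup generated by the support of `μ(z)`. Every
limit point of these averages is stationary, and a Choquet–Deny maximum principle identifies it.
This gives (i). For (ii), the average of two Haar measures has the union of the two subgroups as its
support, so (i) applies to it. Measurability comes along: `Y ↦ m_Y` is an embedding
(`isEmbedding_haarProb`), so it is enough that the Haar measures are limits of measurable maps.

For (iii), the Haar measures of an increasing sequence of subgroups converge to that of the
generated closed subgroup (`tendsto_haarProb_of_monotone`), which gives countable joins. Nonempty
families of any cardinality reduce to countable ones by exhaustion, using a bounded strictly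
increasing functional (`exists_strictMono_functional`, `exists_isLUB_of_strictMono`). The empty
family is handled by the trivial subgroup. -/

/-! ### Convolutions and averages of probability measures -/

section Operations

variable {M : Type*} [MeasurableSpace M]

/-- The convolution of two probability measures. -/
def conv [Mul M] [MeasurableMul₂ M] (μ ν : ProbabilityMeasure M) : ProbabilityMeasure M :=
  (μ.prod ν).map (measurable_mul (M := M)).aemeasurable

/-- The average of the first `n + 1` terms of a sequence of probability measures. -/
def average (n : ℕ) (p : ℕ → ProbabilityMeasure M) : ProbabilityMeasure M :=
  ⟨((n + 1 : ℕ) : ℝ≥0∞)⁻¹ • ∑ i ∈ Finset.range (n + 1), (p i : Measure M), ⟨by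
    simp only [Measure.smul_apply, Measure.finsetSum_apply, measure_univ, Finset.sum_const,
      Finset.card_range, smul_eq_mul, nsmul_eq_mul, mul_one]
    exact ENNReal.inv_mul_cancel (by simp) (ENNReal.natCast_ne_top _)⟩⟩

theorem coe_average (n : ℕ) (p : ℕ → ProbabilityMeasure M) :
    (average n p : Measure M) =
      ((n + 1 : ℕ) : ℝ≥0∞)⁻¹ • ∑ i ∈ Finset.range (n + 1), (p i : Measure M) := rfl

/-- The Dirac measure as a probability measure. -/
def diracProb (x : M) : ProbabilityMeasure M := ⟨Measure.dirac x, inferInstance⟩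

theorem ae_average {n : ℕ} {p : ℕ → ProbabilityMeasure M} {P : M → Prop}
    (h : ∀ i ≤ n, ∀ᵐ x ∂(p i : Measure M), P x) : ∀ᵐ x ∂(average n p : Measure M), P x := by
  rw [coe_average]
  refine Measure.ae_smul_measure ?_ _
  rw [← Measure.sum_coe_finset]
  exact Measure.ae_sum_iff.2 fun i => h i (by have := Finset.mem_range.1 i.2; omega)

theorem ae_conv [Mul M] [MeasurableMul₂ M] {μ ν : ProbabilityMeasure M} {s : Set M}
    (hs : MeasurableSet s) (hmul : ∀ x ∈ s, ∀ y ∈ s, x * y ∈ s)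
    (hμ : ∀ᵐ x ∂(μ : Measure M), x ∈ s) (hν : ∀ᵐ x ∂(ν : Measure M), x ∈ s) :
    ∀ᵐ x ∂(conv μ ν : Measure M), x ∈ s := by
  change ∀ᵐ x ∂(((μ : Measure M).prod (ν : Measure M)).map (fun p : M × M => p.1 * p.2)), x ∈ s
  refine (ae_map_iff (p := (· ∈ s)) measurable_mul.aemeasurable hs).2 ?_
  filter_upwards [Measure.quasiMeasurePreserving_fst.ae hμ,
    Measure.quasiMeasurePreserving_snd.ae hν] with p h1 h2
  exact hmul _ h1 _ h2

end Operations

/-! ### Integrals of bounded continuous functions and weak-star limits -/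

section Integrals

variable {X : Type*} [TopologicalSpace X] [MeasurableSpace X] [OpensMeasurableSpace X]

theorem integrable_bcf (μ : ProbabilityMeasure X) (f : X →ᵇ ℝ) :
    Integrable (fun x => f x) (μ : Measure X) :=
  f.integrable _

theorem abs_integral_sub_le_dist (μ : ProbabilityMeasure X) (f g : X →ᵇ ℝ) :
    |∫ x, f x ∂(μ : Measure X) - ∫ x, g x ∂(μ : Measure X)| ≤ dist f g := by
  rw [← integral_sub (integrable_bcf μ f) (integrable_bcf μ g)]
  rw [← Real.norm_eq_abs, ← mul_one (dist f g), ← probReal_univ (μ := (μ : Measure X))]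
  refine norm_integral_le_of_norm_le_const (Eventually.of_forall fun y => ?_)
  exact BoundedContinuousFunction.dist_coe_le_dist (f := f) (g := g) y

theorem integral_average (n : ℕ) (p : ℕ → ProbabilityMeasure X) (f : X →ᵇ ℝ) :
    ∫ x, f x ∂(average n p : Measure X) =
      ((n : ℝ) + 1)⁻¹ * ∑ i ∈ Finset.range (n + 1), ∫ x, f x ∂(p i : Measure X) := by
  rw [coe_average, integral_smul_measure, integral_finsetSum_measure
    (fun i _ => integrable_bcf (p i) f), smul_eq_mul, ENNReal.toReal_inv, ENNReal.toReal_natCast]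
  push_cast
  rfl

theorem continuous_average {Z : Type*} [TopologicalSpace Z] (n : ℕ)
    {p : ℕ → Z → ProbabilityMeasure X} (hp : ∀ i, Continuous (p i)) :
    Continuous fun z => average n fun i => p i z := by
  rw [continuous_iff_continuousAt]
  intro z
  refine ProbabilityMeasure.tendsto_iff_forall_integral_tendsto.2 fun f => ?_
  simp only [integral_average]
  refine Tendsto.const_mul _ (tendsto_finsetSum _ fun i _ => ?_)
  exact ProbabilityMeasure.tendsto_iff_forall_integral_tendsto.1 ((hp i).tendsto z) f

/-- The portmanteau inequality for closed sets: the mass of `C` cannot drop in the limit. -/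
theorem ae_mem_of_tendsto [HasOuterApproxClosed X] {ι : Type*} {l : Filter ι} [l.NeBot]
    {p : ι → ProbabilityMeasure X} {q : ProbabilityMeasure X} (h : Tendsto p l (𝓝 q))
    {C : Set X} (hC : IsClosed C) (hp : ∀ᶠ i in l, ∀ᵐ x ∂(p i : Measure X), x ∈ C) :
    ∀ᵐ x ∂(q : Measure X), x ∈ C := by
  have h1 := ProbabilityMeasure.limsup_measure_closed_le_of_tendsto h hC
  have h2 : limsup (fun i => (p i : Measure X) C) l = 1 := by
    rw [limsup_congr (v := fun _ => 1), limsup_const]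
    filter_upwards [hp] with i hi
    exact prob_compl_eq_zero_iff hC.measurableSet |>.1 hi
  rw [h2] at h1
  exact (prob_compl_eq_zero_iff hC.measurableSet).2 (le_antisymm prob_le_one h1)

theorem ext_of_forall_integral [HasOuterApproxClosed X] [BorelSpace X]
    {μ ν : ProbabilityMeasure X}
    (h : ∀ f : X →ᵇ ℝ, ∫ x, f x ∂(μ : Measure X) = ∫ x, f x ∂(ν : Measure X)) : μ = ν :=
  Subtype.ext (ext_of_forall_integral_eq_of_IsFiniteMeasure (μ := (μ : Measure X))
    (ν := (ν : Measure X)) h)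

end Integrals

/-! ### Convolution powers on a compact group -/

section Group

variable {X : Type*} [Group X] [TopologicalSpace X] [IsTopologicalGroup X] [CompactSpace X]
  [TopologicalSpace.MetrizableSpace X] [MeasurableSpace X] [BorelSpace X]

theorem integral_conv (μ ν : ProbabilityMeasure X) (f : X →ᵇ ℝ) :
    ∫ x, f x ∂(conv μ ν : Measure X) =
      ∫ x, ∫ y, f (x * y) ∂(ν : Measure X) ∂(μ : Measure X) := by
  change ∫ x, f x ∂(((μ : Measure X).prod (ν : Measure X)).map
    (fun p : X × X => p.1 * p.2)) = _
  rw [integral_map measurable_mul.aemeasurable f.continuous.aestronglyMeasurable, integral_prod]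
  exact integrable_bcf (μ.prod ν) (f.compContinuous ⟨fun p : X × X => p.1 * p.2, continuous_mul⟩)

theorem continuous_conv :
    Continuous fun p : ProbabilityMeasure X × ProbabilityMeasure X => conv p.1 p.2 :=
  (ProbabilityMeasure.continuous_map (continuous_mul (M := X))).comp
    ProbabilityMeasure.continuous_prod

/-- Convolution powers. -/
def convPow (μ : ProbabilityMeasure X) : ℕ → ProbabilityMeasure X
  | 0 => diracProb 1
  | n + 1 => conv μ (convPow μ n)

/-- The left translate of a bounded continuous function. -/
def translate (x : X) (f : X →ᵇ ℝ) : X →ᵇ ℝ := f.compContinuous ⟨fun y => x * y, by fun_prop⟩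

@[simp] theorem translate_apply (x : X) (f : X →ᵇ ℝ) (y : X) : translate x f y = f (x * y) := rfl

/-- Continuity is for the sup norm. Currying the continuous map `(x, y) ↦ f (x * y)` provides it,
because on a compact space the compact-open topology is that of uniform convergence. -/
theorem continuous_translate (f : X →ᵇ ℝ) : Continuous fun x : X => translate x f := by
  let F : C(X, C(X, ℝ)) := ContinuousMap.curry ⟨fun p : X × X => f (p.1 * p.2), by fun_prop⟩
  have h : (fun x : X => translate x f) = fun x => BoundedContinuousFunction.mkOfCompact (F x) := by
    ext x y
    rfl
  rw [h]
  exact (ContinuousMap.isometryEquivBoundedOfCompact X ℝ).continuous.comp F.continuous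

theorem continuous_integral_translate (μ : ProbabilityMeasure X) (f : X →ᵇ ℝ) :
    Continuous fun x : X => ∫ y, f (x * y) ∂(μ : Measure X) := by
  refine continuous_iff_continuousAt.2 fun x => ?_
  rw [ContinuousAt, tendsto_iff_dist_tendsto_zero]
  have h0 := tendsto_iff_dist_tendsto_zero.1 ((continuous_translate f).tendsto x)
  refine squeeze_zero (fun _ => dist_nonneg) (fun z => ?_) h0
  exact abs_integral_sub_le_dist μ (translate z f) (translate x f)

theorem conv_average (μ : ProbabilityMeasure X) (n : ℕ) (p : ℕ → ProbabilityMeasure X) :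
    conv μ (average n p) = average n fun i => conv μ (p i) := by
  refine ext_of_forall_integral fun f => ?_
  simp only [integral_conv, integral_average]
  have h : ∀ x, ∫ y, f (x * y) ∂(average n p : Measure X) = _ :=
    fun x => integral_average n p (translate x f)
  simp only [h, translate_apply]
  rw [integral_const_mul, integral_finsetSum]
  intro i _
  exact (BoundedContinuousFunction.mkOfCompact
    ⟨_, continuous_integral_translate (p i) f⟩).integrable _

/-- Convolving with `μ` shifts the powers by one, so the difference telescopes to the powers `n + 1`
and `0`. Hence limit points of the averages are stationary. -/
theorem abs_integral_conv_average_sub_le (μ : ProbabilityMeasure X) (n : ℕ) (f : X →ᵇ ℝ) :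
    |∫ x, f x ∂(conv μ (average n (convPow μ)) : Measure X) -
      ∫ x, f x ∂(average n (convPow μ) : Measure X)| ≤ (2 * ‖f‖) / ((n : ℝ) + 1) := by
  have hb : ∀ ν : ProbabilityMeasure X, |∫ x, f x ∂(ν : Measure X)| ≤ ‖f‖ := fun ν => by
    refine (norm_integral_le_of_norm_le_const (C := ‖f‖)
      (Eventually.of_forall fun y => f.norm_coe_le_norm y)).trans (by simp)
  rw [conv_average, integral_average, integral_average, ← mul_sub, ← Finset.sum_sub_distrib]
  have h : ∑ i ∈ Finset.range (n + 1), (∫ x, f x ∂(conv μ (convPow μ i) : Measure X) -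
      ∫ x, f x ∂(convPow μ i : Measure X)) = ∫ x, f x ∂(convPow μ (n + 1) : Measure X) -
      ∫ x, f x ∂(convPow μ 0 : Measure X) :=
    Finset.sum_range_sub (fun i => ∫ x, f x ∂(convPow μ i : Measure X)) (n + 1)
  rw [h, abs_mul, abs_of_pos (by positivity),
    div_eq_inv_mul]
  refine mul_le_mul_of_nonneg_left ?_ (by positivity)
  refine (abs_sub _ _).trans ?_
  rw [two_mul]
  exact add_le_add (hb _) (hb _)

end Group

section HaarMeasures

/-! ### Haar measures of closed subgroups -/

variable {X : Type*} [Group X] [TopologicalSpace X] [IsTopologicalGroup X] [CompactSpace X]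
  [MeasurableSpace X] [BorelSpace X]

instance compactSpace_toSubgroup (Y : ClosedSubgroup X) : CompactSpace Y.toSubgroup :=
  isCompact_iff_compactSpace.mp Y.isClosed'.isCompact

theorem coe_haarProb (Y : ClosedSubgroup X) :
    (haarProb Y : Measure X) = (Measure.haarMeasure
      (⊤ : TopologicalSpace.PositiveCompacts Y.toSubgroup)).map Subtype.val := rfl

theorem ae_mem_haarProb (Y : ClosedSubgroup X) : ∀ᵐ x ∂(haarProb Y : Measure X), x ∈ Y := by
  rw [coe_haarProb]
  refine (ae_map_iff (p := (· ∈ (Y : Set X))) measurable_subtype_coe.aemeasurable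
    Y.isClosed'.measurableSet).2 (Eventually.of_forall fun y => y.2)

theorem integral_haarProb (Y : ClosedSubgroup X) (f : X → ℝ) :
    ∫ x, f x ∂(haarProb Y : Measure X) = ∫ x : Y.toSubgroup, f x ∂(Measure.haarMeasure
      (⊤ : TopologicalSpace.PositiveCompacts Y.toSubgroup)) := by
  rw [coe_haarProb]
  exact (MeasurableEmbedding.subtype_coe Y.isClosed'.measurableSet).integral_map _

theorem integral_mul_left_haarProb (Y : ClosedSubgroup X) {y : X} (hy : y ∈ Y) (f : X → ℝ) :
    ∫ x, f (y * x) ∂(haarProb Y : Measure X) = ∫ x, f x ∂(haarProb Y : Measure X) := by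
  rw [integral_haarProb, integral_haarProb]
  exact integral_mul_left_eq_self (fun x : Y.toSubgroup => f x) (⟨y, hy⟩ : Y.toSubgroup)

/-- Haar measure charges every nonempty relatively open subset of `Y`. In particular a closed
subgroup is recovered from its Haar measure. -/
theorem support_haarProb [SecondCountableTopology X] (Y : ClosedSubgroup X) :
    (haarProb Y : Measure X).support = Y := by
  refine subset_antisymm
    (Measure.support_subset_of_isClosed Y.isClosed' (ae_mem_haarProb Y)) fun y hy => ?_
  rw [Measure.mem_support_iff_forall]
  intro U hU
  obtain ⟨V, hVU, hV, hyV⟩ := mem_nhds_iff.1 hU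
  refine lt_of_lt_of_le ?_ (measure_mono hVU)
  rw [coe_haarProb, Measure.map_apply measurable_subtype_coe hV.measurableSet]
  exact (hV.preimage continuous_subtype_val).measure_pos _ ⟨(⟨y, hy⟩ : Y.toSubgroup), hyV⟩

theorem haarProb_injective [SecondCountableTopology X] :
    Function.Injective (haarProb : ClosedSubgroup X → ProbabilityMeasure X) := fun _ _ h =>
  SetLike.coe_injective (by rw [← support_haarProb, ← support_haarProb, h])

variable [TopologicalSpace.MetrizableSpace X]

/-- A probability measure that is concentrated on a closed subgroup and is invariant under left
translations by its elements is the Haar measure. -/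
theorem eq_haarProb {lam : ProbabilityMeasure X} {Y : ClosedSubgroup X}
    (hY : ∀ᵐ x ∂(lam : Measure X), x ∈ Y)
    (hinv : ∀ y ∈ Y, ∀ f : X →ᵇ ℝ,
      ∫ x, f (y * x) ∂(lam : Measure X) = ∫ x, f x ∂(lam : Measure X)) :
    lam = haarProb Y := by
  have hYm : MeasurableSet (Y : Set X) := Y.isClosed'.measurableSet
  have : SecondCountableTopology Y.toSubgroup :=
    inferInstanceAs (SecondCountableTopology (Y : Set X))
  have hemb : MeasurableEmbedding (Subtype.val : Y.toSubgroup → X) :=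
    MeasurableEmbedding.subtype_coe hYm
  -- Viewed as a measure on `Y` itself, `lam` is a left-invariant probability measure, and
  -- uniqueness of Haar measure applies there.
  let κ : Measure Y.toSubgroup := (lam : Measure X).comap Subtype.val
  have hmap : κ.map Subtype.val = (lam : Measure X) := by
    rw [hemb.map_comap, Subtype.range_coe]
    exact Measure.restrict_eq_self_of_ae_mem hY
  have : IsProbabilityMeasure κ := by
    refine ⟨?_⟩
    have h1 : (κ.map Subtype.val) univ = 1 := by rw [hmap, measure_univ]
    rwa [Measure.map_apply measurable_subtype_coe MeasurableSet.univ, preimage_univ] at h1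
  have htrans : ∀ y ∈ Y, (lam : Measure X).map (fun x => y * x) = (lam : Measure X) := by
    intro y hy
    have : IsProbabilityMeasure ((lam : Measure X).map (fun x => y * x)) :=
      Measure.isProbabilityMeasure_map (measurable_const_mul y).aemeasurable
    refine ext_of_forall_integral_eq_of_IsFiniteMeasure fun f => ?_
    rw [integral_map (measurable_const_mul y).aemeasurable f.continuous.aestronglyMeasurable]
    exact hinv y hy f
  have : κ.IsMulLeftInvariant := by
    refine ⟨fun y => ?_⟩
    have h1 : ((κ.map (fun x => y * x)).map Subtype.val) = κ.map Subtype.val := by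
      rw [Measure.map_map measurable_subtype_coe (measurable_const_mul y)]
      have h2 : (Subtype.val ∘ fun x : Y.toSubgroup => y * x) =
        (fun x : X => (y : X) * x) ∘ Subtype.val := rfl
      rw [h2, ← Measure.map_map (measurable_const_mul _) measurable_subtype_coe, hmap]
      exact htrans y y.2
    have h3 := congrArg (Measure.comap (Subtype.val : Y.toSubgroup → X)) h1
    rwa [hemb.comap_map, hemb.comap_map] at h3
  have hκ : κ = Measure.haarMeasure (⊤ : TopologicalSpace.PositiveCompacts Y.toSubgroup) := by
    have h1 := Measure.haarMeasure_unique κ (⊤ : TopologicalSpace.PositiveCompacts Y.toSubgroup)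
    rwa [TopologicalSpace.PositiveCompacts.coe_top, measure_univ, one_smul] at h1
  refine Subtype.ext ?_
  change (lam : Measure X) = (haarProb Y : Measure X)
  rw [coe_haarProb, ← hκ, hmap]

theorem subset_closedSubgroupGen (s : Set X) : s ⊆ closedSubgroupGen s :=
  Subgroup.subset_closure.trans (Subgroup.le_topologicalClosure _)

theorem closedSubgroupGen_le {s : Set X} {Y : ClosedSubgroup X} (h : s ⊆ Y) :
    closedSubgroupGen s ≤ Y :=
  Subgroup.topologicalClosure_minimal _ ((Subgroup.closure_le _).2 h) Y.isClosed'

/-- The Choquet–Deny argument: a stationary measure of a random walk on a compact group which is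
concentrated on the closed subgroup generated by the steps is its Haar measure. -/
theorem eq_haarProb_of_conv_eq {μ lam : ProbabilityMeasure X}
    (hconv : conv μ lam = lam)
    (hlam : ∀ᵐ x ∂(lam : Measure X), x ∈ closedSubgroupGen (μ : Measure X).support) :
    lam = haarProb (closedSubgroupGen (μ : Measure X).support) := by
  set Y := closedSubgroupGen (μ : Measure X).support with hYdef
  have hμY : ∀ᵐ x ∂(μ : Measure X), x ∈ Y :=
    Filter.mem_of_superset Measure.support_mem_ae (subset_closedSubgroupGen _)
  refine eq_haarProb hlam fun y hy f => ?_
  let F : X → ℝ := fun x => ∫ y, f (x * y) ∂(lam : Measure X)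
  have hFc : Continuous F := continuous_integral_translate lam f
  -- Stationarity of `lam`, tested on translates of `f`, says that `F` is harmonic for the right
  -- random walk with step law `μ`.
  have hharm : ∀ x, ∫ g, F (x * g) ∂(μ : Measure X) = F x := fun x => by
    have h1 := integral_conv μ lam (translate x f)
    rw [hconv] at h1
    simp only [translate_apply, ← mul_assoc] at h1
    exact h1.symm
  have hYc : IsCompact (Y : Set X) := Y.isClosed'.isCompact
  obtain ⟨x₀, hx₀, hmax⟩ := hYc.exists_isMaxOn ⟨1, Y.one_mem'⟩ hFc.continuousOn
  -- Maximum principle: where `F` attains its maximum over `Y`, its average over one step equals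
  -- that maximum, so `F` is maximal after almost every step, and by continuity after every step in
  -- the support.
  have hstep : ∀ x ∈ Y, F x = F x₀ → ∀ g ∈ (μ : Measure X).support, F (x * g) = F x₀ := by
    intro x hx hFx
    have hnn : 0 ≤ᵐ[(μ : Measure X)] fun g => F x₀ - F (x * g) := by
      filter_upwards [hμY] with g hg
      exact sub_nonneg.2 (hmax (mul_mem hx hg))
    have hint : Integrable (fun g => F (x * g)) (μ : Measure X) :=
      (BoundedContinuousFunction.mkOfCompact ⟨fun g => F (x * g), by fun_prop⟩).integrable _
    have h0 : ∫ g, (F x₀ - F (x * g)) ∂(μ : Measure X) = 0 := by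
      rw [integral_sub (integrable_const _) hint, hharm x, hFx]
      simp
    have hae := (integral_eq_zero_iff_of_nonneg_ae hnn ((integrable_const _).sub hint)).1 h0
    have hcl : IsClosed {g | F (x * g) = F x₀} := isClosed_eq (by fun_prop) continuous_const
    refine Measure.support_subset_of_isClosed hcl ?_
    filter_upwards [hae] with g hg
    exact (sub_eq_zero.1 hg).symm
  have hconst : ∀ g ∈ Y, F (x₀ * g) = F x₀ := by
    -- Iterating the steps reaches only the submonoid they generate. This suffices, since in a
    -- compact group its closure is already the closed subgroup generated.
    have hmon : (Submonoid.closure (μ : Measure X).support : Set X) ⊆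
        {g | g ∈ Y ∧ F (x₀ * g) = F x₀} := by
      intro g hg
      induction hg using Submonoid.closure_induction_right with
      | one => exact ⟨one_mem _, by simp⟩
      | mul_right a ha b hb ih =>
        refine ⟨mul_mem ih.1 (subset_closedSubgroupGen _ hb), ?_⟩
        rw [← mul_assoc]
        exact hstep _ (mul_mem hx₀ ih.1) ih.2 b hb
    have hcl : IsClosed {g | F (x₀ * g) = F x₀} := isClosed_eq (by fun_prop) continuous_const
    intro g hg
    have hg' : g ∈ (Subgroup.closure (μ : Measure X).support).topologicalClosure := hg
    rw [← SetLike.mem_coe, Subgroup.topologicalClosure_coe,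
      ← closure_submonoidClosure_eq_closure_subgroupClosure] at hg'
    exact closure_minimal (hmon.trans fun g hg => hg.2) hcl hg'
  have h1 := hconst (x₀⁻¹ * y) (mul_mem (inv_mem hx₀) hy)
  have h2 := hconst (x₀⁻¹ * 1) (mul_mem (inv_mem hx₀) (one_mem _))
  rw [mul_inv_cancel_left] at h1 h2
  have h3 := h1.trans h2.symm
  simpa only [F, one_mul] using h3

/-- The Kawada–Itô theorem: the averages of the convolution powers of a probability measure on
a compact group converge to the Haar measure of the closed subgroup generated by its support. -/
theorem tendsto_average_convPow (μ : ProbabilityMeasure X) :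
    Tendsto (fun n => average n (convPow μ)) atTop
      (𝓝 (haarProb (closedSubgroupGen (μ : Measure X).support))) := by
  -- The space of probability measures is compact, so it is enough to identify the limit along each
  -- ultrafilter.
  refine tendsto_iff_ultrafilter _ _ _ |>.2 fun 𝒰 h𝒰 => ?_
  obtain ⟨lam, -, hlam⟩ := isCompact_univ.ultrafilter_le_nhds
    (𝒰.map fun n => average n (convPow μ)) (by simp)
  have hlam' : Tendsto (fun n => average n (convPow μ)) (𝒰 : Filter ℕ) (𝓝 lam) := hlam
  have hY : ∀ n, ∀ᵐ x ∂(average n (convPow μ) : Measure X),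
      x ∈ closedSubgroupGen (μ : Measure X).support := fun n => by
    refine ae_average fun i _ => ?_
    induction i with
    | zero =>
      change ∀ᵐ x ∂(Measure.dirac (1 : X)), x ∈ closedSubgroupGen (μ : Measure X).support
      refine (ae_dirac_iff (p := (· ∈ closedSubgroupGen (μ : Measure X).support))
        (closedSubgroupGen (μ : Measure X).support).isClosed'.measurableSet).2 (one_mem _)
    | succ i ih =>
      exact ae_conv (μ := μ) (ν := convPow μ i) (s := closedSubgroupGen (μ : Measure X).support)
        (closedSubgroupGen (μ : Measure X).support).isClosed'.measurableSet
        (fun x hx y hy => mul_mem hx hy)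
        (Filter.mem_of_superset Measure.support_mem_ae
          (subset_closedSubgroupGen _)) (ih (by omega))
  have hconv : conv μ lam = lam := by
    refine ext_of_forall_integral fun f => ?_
    have h1 := ProbabilityMeasure.tendsto_iff_forall_integral_tendsto.1 hlam' f
    have h2 := ProbabilityMeasure.tendsto_iff_forall_integral_tendsto.1
      ((continuous_conv.tendsto (μ, lam)).comp (tendsto_const_nhds.prodMk_nhds hlam')) f
    have h3 : Tendsto (fun n : ℕ => (2 * ‖f‖) / ((n : ℝ) + 1)) (𝒰 : Filter ℕ) (𝓝 0) :=
      (tendsto_const_nhds.div_atTop (tendsto_atTop_add_const_right _ _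
        tendsto_natCast_atTop_atTop)).mono_left h𝒰
    have h4 := squeeze_zero_norm (f := fun n : ℕ =>
      ∫ x, f x ∂(conv μ (average n (convPow μ)) : Measure X) -
        ∫ x, f x ∂(average n (convPow μ) : Measure X))
      (fun n => abs_integral_conv_average_sub_le μ n f) h3
    exact sub_eq_zero.1 (tendsto_nhds_unique (h2.sub h1) h4)
  have := eq_haarProb_of_conv_eq hconv
    (ae_mem_of_tendsto hlam' (closedSubgroupGen _).isClosed' (Eventually.of_forall hY))
  rw [← this]
  exact hlam'

end HaarMeasures

/-! ### The topology of the space of closed subgroups -/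

section Topology

variable {X : Type*} [Group X] [TopologicalSpace X] [CompactSpace X]

theorem coe_toNonemptyCompacts (Y : ClosedSubgroup X) :
    (toNonemptyCompacts Y : Set X) = Y := rfl

theorem toNonemptyCompacts_injective :
    Function.Injective (toNonemptyCompacts : ClosedSubgroup X → _) := fun _ _ h =>
  SetLike.coe_injective (congrArg (fun K : TopologicalSpace.NonemptyCompacts X => (K : Set X)) h)

theorem isEmbedding_toNonemptyCompacts :
    IsEmbedding (toNonemptyCompacts : ClosedSubgroup X → _) :=
  ⟨⟨rfl⟩, toNonemptyCompacts_injective⟩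

instance [TopologicalSpace.MetrizableSpace X] :
    TopologicalSpace.MetrizableSpace (ClosedSubgroup X) :=
  isEmbedding_toNonemptyCompacts.metrizableSpace

/-- A nonempty compact `K` is a subgroup exactly when `K / K = K`. This equation is closed in the
compact hyperspace, because `K ↦ K / K` is continuous. -/
instance [T2Space X] [IsTopologicalGroup X] : CompactSpace (ClosedSubgroup X) := by
  have hc : Continuous fun p : X × X => p.1 / p.2 := continuous_fst.div' continuous_snd
  have h : range (toNonemptyCompacts : ClosedSubgroup X → _) =
      {K | (K ×ˢ K).map (fun p : X × X => p.1 / p.2) hc = K} := by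
    ext K
    constructor
    · rintro ⟨Y, rfl⟩
      refine SetLike.coe_injective ?_
      rw [TopologicalSpace.NonemptyCompacts.coe_map, TopologicalSpace.NonemptyCompacts.coe_prod]
      refine subset_antisymm ?_ fun y hy => ⟨(y, 1), ⟨hy, Y.one_mem'⟩, div_one y⟩
      rintro _ ⟨p, hp, rfl⟩
      exact div_mem (H := Y) hp.1 hp.2
    · intro hK
      have hdiv : ∀ x ∈ K, ∀ y ∈ K, x / y ∈ K := fun x hx y hy => by
        rw [← show _ = K from hK]
        exact ⟨(x, y), ⟨hx, hy⟩, rfl⟩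
      obtain ⟨x, hx⟩ := K.nonempty
      exact ⟨⟨Subgroup.ofDiv (K : Set X) ⟨x, hx⟩ 
          (by simpa only [div_eq_mul_inv, SetLike.mem_coe] using hdiv), K.isCompact.isClosed⟩,
        SetLike.coe_injective rfl⟩
  have hcl : IsClosed (range (toNonemptyCompacts : ClosedSubgroup X → _)) := by
    rw [h]
    exact isClosed_eq (hc.nonemptyCompacts_map.comp
      (TopologicalSpace.NonemptyCompacts.continuous_prod.comp
        (continuous_id.prodMk continuous_id))) continuous_id
  exact (IsClosedEmbedding.mk isEmbedding_toNonemptyCompacts hcl).compactSpace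

theorem eventually_subset {Y : ClosedSubgroup X} {U : Set X} (hU : IsOpen U)
    (h : (Y : Set X) ⊆ U) : ∀ᶠ Y' : ClosedSubgroup X in 𝓝 Y, (Y' : Set X) ⊆ U :=
  ((TopologicalSpace.NonemptyCompacts.isOpen_subsets_of_isOpen hU).preimage
    isEmbedding_toNonemptyCompacts.continuous).mem_nhds h

theorem eventually_inter_nonempty {Y : ClosedSubgroup X} {U : Set X} (hU : IsOpen U)
    (h : ((Y : Set X) ∩ U).Nonempty) :
    ∀ᶠ Y' : ClosedSubgroup X in 𝓝 Y, ((Y' : Set X) ∩ U).Nonempty :=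
  ((TopologicalSpace.NonemptyCompacts.isOpen_inter_nonempty_of_isOpen hU).preimage
    isEmbedding_toNonemptyCompacts.continuous).mem_nhds h

end Topology

/-! ### Continuity of Haar measure in the subgroup -/

section Haar

variable {X : Type*} [Group X] [TopologicalSpace X] [IsTopologicalGroup X] [CompactSpace X]
  [TopologicalSpace.MetrizableSpace X] [MeasurableSpace X] [BorelSpace X]

/-- The elements whose left translation preserves `lam` form a closed subgroup, so invariance need
only be checked on generators. -/
theorem eq_haarProb_closedSubgroupGen {lam : ProbabilityMeasure X} {s : Set X}
    (hs : ∀ᵐ x ∂(lam : Measure X), x ∈ closedSubgroupGen s)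
    (hinv : ∀ y ∈ s, ∀ f : X →ᵇ ℝ,
      ∫ x, f (y * x) ∂(lam : Measure X) = ∫ x, f x ∂(lam : Measure X)) :
    lam = haarProb (closedSubgroupGen s) := by
  have hsub : ∀ y ∈ Subgroup.closure s, ∀ f : X →ᵇ ℝ,
      ∫ x, f (y * x) ∂(lam : Measure X) = ∫ x, f x ∂(lam : Measure X) := by
    intro y hy
    induction hy using Subgroup.closure_induction with
    | mem y hy => exact hinv y hy
    | one => simp
    | mul a b ha hb iha ihb =>
      intro f
      have := ihb (translate a f)
      simp only [translate_apply, ← mul_assoc] at this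
      rw [this, iha f]
    | inv a ha iha =>
      intro f
      have := iha (translate a⁻¹ f)
      simp only [translate_apply, inv_mul_cancel_left] at this
      exact this.symm
  refine eq_haarProb hs fun y hy f => ?_
  exact closure_minimal (s := (Subgroup.closure s : Set X))
    (t := {y | ∫ x, f (y * x) ∂(lam : Measure X) = ∫ x, f x ∂(lam : Measure X)})
    (fun y hy => hsub y hy f)
    (isClosed_eq (continuous_integral_translate lam f) continuous_const) hy

theorem continuous_haarProb :
    Continuous (haarProb : ClosedSubgroup X → ProbabilityMeasure X) := by
  refine continuous_iff_ultrafilter.2 fun Y 𝒰 h𝒰 => ?_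
  obtain ⟨lam, -, hlam⟩ := isCompact_univ.ultrafilter_le_nhds (𝒰.map haarProb) (by simp)
  have hlam' : Tendsto haarProb (𝒰 : Filter (ClosedSubgroup X)) (𝓝 lam) := hlam
  -- This uses the upper half of the Vietoris topology: nearby subgroups stay inside any open set
  -- containing `Y`.
  have hsupp : (lam : Measure X).support ⊆ Y := by
    intro x hx
    by_contra hxY
    obtain ⟨U, W, hU, hW, hxU, hYW, hUW⟩ := SeparatedNhds.of_isCompact_isCompact
      (isCompact_singleton (x := x)) Y.isClosed'.isCompact (disjoint_singleton_left.2 hxY)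
    have h1 : ∀ᵐ x ∂(lam : Measure X), x ∈ Uᶜ := by
      refine ae_mem_of_tendsto hlam' hU.isClosed_compl ?_
      filter_upwards [h𝒰 (eventually_subset hW hYW)] with Y' hY'
      filter_upwards [ae_mem_haarProb Y'] with x hx
      exact fun hxU => disjoint_left.1 hUW hxU (hY' hx)
    exact Measure.support_subset_of_isClosed hU.isClosed_compl h1 hx (hxU rfl)
  have : lam = haarProb Y := by
    refine eq_haarProb (Filter.mem_of_superset Measure.support_mem_ae hsupp) fun y hy f => ?_
    have h1 := ProbabilityMeasure.tendsto_iff_forall_integral_tendsto.1 hlam' f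
    have h2 := ProbabilityMeasure.tendsto_iff_forall_integral_tendsto.1 hlam' (translate y f)
    refine eq_of_forall_dist_le fun ε hε => ?_
    refine le_of_tendsto (h2.dist h1) ?_
    have hV : IsOpen {v | dist (translate y f) (translate v f) < ε} :=
      isOpen_lt (continuous_const.dist (continuous_translate f)) continuous_const
    -- This is the lower half: nearby subgroups contain some `v` whose translate of `f` is uniformly
    -- `ε`-close to that by `y`, and `m_{Y'}` is invariant under `v`.
    filter_upwards [h𝒰 (eventually_inter_nonempty hV ⟨y, hy, by simpa using hε⟩)] with Y' hY'
    obtain ⟨v, hv, hvε⟩ := hY'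
    rw [← integral_mul_left_haarProb Y' hv f]
    exact (abs_integral_sub_le_dist _ (translate y f) (translate v f)).trans (le_of_lt hvε)
  rw [← this]
  exact hlam'

/-- A continuous injection from a compact space to a Hausdorff space. It lets measurability of a
family of subgroups be tested on its Haar measures. -/
theorem isEmbedding_haarProb :
    IsEmbedding (haarProb : ClosedSubgroup X → ProbabilityMeasure X) :=
  (continuous_haarProb.isClosedEmbedding haarProb_injective).isEmbedding

theorem tendsto_haarProb_of_monotone {W : ℕ → ClosedSubgroup X} (hW : Monotone W) :
    Tendsto (fun n => haarProb (W n)) atTop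
      (𝓝 (haarProb (closedSubgroupGen (⋃ n, (W n : Set X))))) := by
  refine tendsto_iff_ultrafilter _ _ _ |>.2 fun 𝒰 h𝒰 => ?_
  obtain ⟨lam, -, hlam⟩ := isCompact_univ.ultrafilter_le_nhds
    (𝒰.map fun n => haarProb (W n)) (by simp)
  have hlam' : Tendsto (fun n => haarProb (W n)) (𝒰 : Filter ℕ) (𝓝 lam) := hlam
  have : lam = haarProb (closedSubgroupGen (⋃ n, (W n : Set X))) := by
    refine eq_haarProb_closedSubgroupGen ?_ fun y hy f => ?_
    · refine ae_mem_of_tendsto hlam' (closedSubgroupGen _).isClosed'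
        (Eventually.of_forall fun n => ?_)
      filter_upwards [ae_mem_haarProb (W n)] with x hx
      exact subset_closedSubgroupGen _ (mem_iUnion.2 ⟨n, hx⟩)
    · obtain ⟨m, hm⟩ := mem_iUnion.1 hy
      have h1 := ProbabilityMeasure.tendsto_iff_forall_integral_tendsto.1 hlam' f
      have h2 := ProbabilityMeasure.tendsto_iff_forall_integral_tendsto.1 hlam' (translate y f)
      refine tendsto_nhds_unique_of_eventuallyEq h2 h1 ?_
      filter_upwards [h𝒰 (eventually_ge_atTop m)] with n hn
      exact integral_mul_left_haarProb (W n) (hW hn hm) f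
  rw [← this]
  exact hlam'

end Haar

section DiagonalSequences

/-! ### Diagonal sequences along the ultrafilter -/

variable {ω : Ultrafilter ℕ} {d : ℕ → ℕ}

theorem isProbabilityMeasure_loebMeasure [∀ k, NeZero (d k)] (hω : (ω : Filter ℕ) ≤ cofinite) :
    IsProbabilityMeasure (loebMeasure ω d) := by
  refine ⟨?_⟩
  have h : (univ : Set (LoebSpace ω d)) = internalSet ω fun _ => univ := by
    ext z
    obtain ⟨j, rfl⟩ := z.exists_rep
    simp [mk_mem_internalSet]
  rw [h, loebMeasure_internalSet hω]
  refine tendsto_nhds_unique (tendsto_density _) (tendsto_const_nhds.congr fun k => ?_)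
  simp [unif, ncard_univ]

/-- Suppose that for each `n` the functions `f n k` on `{1, …, d k}` converge along `ω` to `F n`
and that `F n` converges almost everywhere to `H`. Then some diagonal choice `f (N k) k` converges
to `H`, and it can be made to satisfy conditions, indexed by a level `m k → ∞`, each of which holds
`ω`-almost surely. -/
theorem exists_diagonal [∀ k, NeZero (d k)] (hω : (ω : Filter ℕ) ≤ cofinite)
    {M : Type*} [PseudoEMetricSpace M] {f : ℕ → ∀ k, Fin (d k) → M}
    {F : ℕ → LoebSpace ω d → M} {H : LoebSpace ω d → M}
    (hf : ∀ n, ∀ᵐ z ∂(loebMeasure ω d), ∀ j : ∀ k, Fin (d k), LoebSpace.mk ω j = z →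
      Tendsto (fun k => f n k (j k)) (ω : Filter ℕ) (𝓝 (F n z)))
    (hF : ∀ n, AEStronglyMeasurable (F n) (loebMeasure ω d))
    (hlim : ∀ᵐ z ∂(loebMeasure ω d), Tendsto (fun n => F n z) atTop (𝓝 (H z)))
    {E : ℕ → ℕ → Set ℕ} (hE : ∀ i n, ∀ᶠ k in (ω : Filter ℕ), k ∈ E i n) :
    ∃ N m : ℕ → ℕ, Tendsto m (ω : Filter ℕ) atTop ∧
      (∀ᶠ k in (ω : Filter ℕ), k ∈ E (N k) (m k)) ∧
      ∀ᵐ z ∂(loebMeasure ω d), ∀ j : ∀ k, Fin (d k), LoebSpace.mk ω j = z →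
        Tendsto (fun k => f (N k) k (j k)) (ω : Filter ℕ) (𝓝 (H z)) := by
  classical
  have := isProbabilityMeasure_loebMeasure (d := d) hω
  let e : ℕ → ℝ≥0∞ := fun n => 2⁻¹ ^ n
  have he0 : ∀ n, 0 < e n := fun n => ENNReal.pow_pos (by simp) n
  have hetop : ∀ n, e n ≠ ∞ := fun n => ENNReal.pow_ne_top (by simp)
  have heanti : ∀ m n, n ≤ m → e m ≤ e n := fun m n h =>
    pow_le_pow_right_of_le_one' (ENNReal.inv_le_one.2 (by norm_num)) h
  have hmeas := tendstoInMeasure_of_tendsto_ae hF hlim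
  -- Pass to a subsequence with summable errors in measure, ready for Borel–Cantelli.
  have hφ : ∀ n, ∃ i ≥ n, loebMeasure ω d {z | e n ≤ edist (F i z) (H z)} ≤ e n := fun n =>
    (((hmeas (e n) (he0 n)).eventually (Iic_mem_nhds (he0 n))).and (eventually_ge_atTop n)).exists.imp
      fun i hi => ⟨hi.2, hi.1⟩
  choose φ hφge hφ using hφ
  let A : ℕ → ℕ → ∀ k, Set (Fin (d k)) := fun n m k =>
    {j | 2 * e n ≤ edist (f (φ m) k j) (f (φ n) k j)}
  -- The triangle inequality through `H` gives density at most `e m + e n ≤ 2 * e n`. The slack up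
  -- to `3 * e n` makes the inequality strict, so that it holds at `ω`-almost every finite stage.
  have hA : ∀ m, ∀ n ≤ m, density ω (A n m) < 3 * e n := by
    intro m n hnm
    have h1 : loebMeasure ω d (internalSet ω (A n m)) ≤ loebMeasure ω d
        ({z | e m ≤ edist (F (φ m) z) (H z)} ∪ {z | e n ≤ edist (F (φ n) z) (H z)}) := by
      refine measure_mono_ae ?_
      filter_upwards [hf (φ m), hf (φ n)] with z hm hn hz
      obtain ⟨j, rfl, hj⟩ := hz
      have h2 : 2 * e n ≤ edist (F (φ m) (LoebSpace.mk ω j)) (F (φ n) (LoebSpace.mk ω j)) :=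
        ge_of_tendsto ((hm j rfl).edist (hn j rfl)) hj
      change e m ≤ edist (F (φ m) (LoebSpace.mk ω j)) (H (LoebSpace.mk ω j)) ∨
        e n ≤ edist (F (φ n) (LoebSpace.mk ω j)) (H (LoebSpace.mk ω j))
      by_contra hcon
      simp only [not_or, not_le] at hcon
      refine absurd h2 (not_le.2 ?_)
      refine (edist_triangle_right _ _ (H (LoebSpace.mk ω j))).trans_lt ?_
      rw [two_mul]
      exact ENNReal.add_lt_add (hcon.1.trans_le (heanti m n hnm)) hcon.2
    rw [← loebMeasure_internalSet hω]
    calc _ ≤ e m + e n := h1.trans ((measure_union_le _ _).trans (add_le_add (hφ m) (hφ n)))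
      _ ≤ 2 * e n := by rw [two_mul]; exact add_le_add_left (heanti m n hnm) _
      _ < 3 * e n := ENNReal.mul_lt_mul_left (he0 n).ne' (hetop n) (by norm_num)
  let D : ℕ → Set ℕ := fun m =>
    {k | k ∈ E (φ m) m ∧ ∀ n ≤ m, ENNReal.ofReal (unif (A n m k)) < 3 * e n}
  have hD : ∀ m, ∀ᶠ k in (ω : Filter ℕ), k ∈ D m := fun m =>
    (hE (φ m) m).and ((eventually_all_finite (finite_Iic m)).2 fun n hn =>
      (tendsto_density (A n m)).eventually (Iio_mem_nhds (hA m n hn)))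
  -- The highest level at most `k` whose requirements hold at `k`. Each fixed level is valid for
  -- `ω`-almost every `k`, and `ω` is free, so `m` tends to infinity along `ω`.
  let m : ℕ → ℕ := fun k => Nat.findGreatest (fun i => k ∈ D i) k
  have hm : ∀ n, ∀ᶠ k in (ω : Filter ℕ), n ≤ m k ∧ k ∈ D (m k) := fun n => by
    have h1 : ∀ᶠ k in (ω : Filter ℕ), n ≤ k :=
      (hω.trans (Nat.cofinite_eq_atTop).le) (eventually_ge_atTop n)
    filter_upwards [h1, hD n] with k hk hkD
    exact ⟨Nat.le_findGreatest hk hkD, Nat.findGreatest_spec (P := fun i => k ∈ D i) hk hkD⟩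
  refine ⟨fun k => φ (m k), m, tendsto_atTop.2 fun n => (hm n).mono fun k hk => hk.1,
    (hm 0).mono fun k hk => hk.2.1, ?_⟩
  let B : ℕ → ∀ k, Set (Fin (d k)) := fun n k =>
    {j | 2 * e n ≤ edist (f (φ (m k)) k j) (f (φ n) k j)}
  have hB : ∀ n, loebMeasure ω d (internalSet ω (B n)) ≤ 3 * e n := fun n => by
    rw [loebMeasure_internalSet hω]
    refine le_of_tendsto (tendsto_density (B n)) ?_
    filter_upwards [hm n] with k hk
    exact (hk.2.2 n hk.1).le
  have hsum : ∑' n, loebMeasure ω d (internalSet ω (B n)) ≠ ∞ := by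
    refine ne_top_of_le_ne_top ?_ (ENNReal.tsum_le_tsum hB)
    rw [ENNReal.tsum_mul_left, ENNReal.tsum_geometric]
    exact ENNReal.mul_ne_top (by simp) (by simp)
  have he : Tendsto (fun n => 2 * e n) atTop (𝓝 0) := by
    have := ENNReal.Tendsto.const_mul (a := 2) (ENNReal.tendsto_pow_atTop_nhds_zero_of_lt_one
      (r := 2⁻¹) (ENNReal.inv_lt_one.2 (by norm_num))) (Or.inr (by simp))
    rwa [mul_zero] at this
  -- By Borel–Cantelli, almost every `z` lies outside the `n`-th bad set for all large `n`. One such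
  -- fixed `n` then links the diagonal choice to `f (φ n)`, then to `F (φ n)`, then to `H`.
  filter_upwards [ae_eventually_notMem hsum, ae_all_iff.2 hf, hlim] with z hz1 hz2 hz3 j hj
  refine EMetric.tendsto_nhds.2 fun ε hε => ?_
  have hε3 : 0 < ε / 3 := ENNReal.div_pos hε.ne' (by simp)
  have hφt : Tendsto φ atTop atTop := tendsto_atTop_mono hφge tendsto_id
  obtain ⟨n, hn1, hn2, hn3⟩ := (hz1.and ((he.eventually (Iio_mem_nhds hε3)).and
    (EMetric.tendsto_nhds.1 (hz3.comp hφt) _ hε3))).exists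
  subst hj
  rw [mk_mem_internalSet, ← Ultrafilter.eventually_not] at hn1
  filter_upwards [hn1, EMetric.tendsto_nhds.1 (hz2 (φ n) j rfl) _ hε3] with k hk1 hk2
  calc edist (f (φ (m k)) k (j k)) (H (LoebSpace.mk ω j))
      ≤ edist (f (φ (m k)) k (j k)) (f (φ n) k (j k)) +
        edist (f (φ n) k (j k)) (F (φ n) (LoebSpace.mk ω j)) +
        edist (F (φ n) (LoebSpace.mk ω j)) (H (LoebSpace.mk ω j)) := edist_triangle4 _ _ _ _
    _ < ε / 3 + ε / 3 + ε / 3 := ENNReal.add_lt_add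
        (ENNReal.add_lt_add ((not_le.1 hk1).trans hn2) hk2) hn3
    _ = ε := ENNReal.add_thirds ε

end DiagonalSequences

/-! ### Closure properties of generalized limits -/

section Unif

theorem unif_mono {n : ℕ} {A B : Set (Fin n)} (h : A ⊆ B) : unif A ≤ unif B :=
  div_le_div_of_nonneg_right (by exact_mod_cast ncard_le_ncard h (toFinite _)) (Nat.cast_nonneg _)

theorem unif_le_one {n : ℕ} (A : Set (Fin n)) : unif A ≤ 1 :=
  div_le_one_of_le₀ (by exact_mod_cast (ncard_le_card A).trans (by simp)) (Nat.cast_nonneg _)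

theorem unif_univ {n : ℕ} [NeZero n] : unif (univ : Set (Fin n)) = 1 := by
  simp [unif, ncard_univ]

theorem unif_add_le {n : ℕ} (A B : Set (Fin n)) : unif A + unif B ≤ unif (A ∩ B) + 1 := by
  have h : unif A + unif B = unif (A ∩ B) + unif (A ∪ B) := by
    unfold unif
    rw [← add_div, ← add_div]
    congr 1
    have := ncard_union_add_ncard_inter A B
    exact_mod_cast (by omega : A.ncard + B.ncard = (A ∩ B).ncard + (A ∪ B).ncard)
  linarith [unif_le_one (A ∪ B)]

end Unif

/-! ### Neighbourhoods of the diagonal -/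

section Diagonal

variable {X : Type*} [TopologicalSpace X] [CompactSpace X] [TopologicalSpace.MetrizableSpace X]

/-- The open neighbourhoods of the diagonal of a compact metrizable space have a countable basis. -/
theorem exists_diagonal_nhds_basis :
    ∃ U : ℕ → Set (X × X), (∀ n, IsOpen (U n)) ∧ (∀ n x, (x, x) ∈ U n) ∧ Antitone U ∧
      ∀ V : Set (X × X), IsOpen V → (∀ x, (x, x) ∈ V) → ∃ n, U n ⊆ V := by
  let _ := TopologicalSpace.metrizableSpaceMetric X
  refine ⟨fun n => {p | dist p.1 p.2 < 1 / ((n : ℝ) + 1)},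
    fun n => isOpen_lt continuous_dist continuous_const, fun n x => ?_, fun m n h p hp => ?_,
    fun V hV hdiag => ?_⟩
  · simpa using (by positivity : (0 : ℝ) < (n : ℝ) + 1)
  · have hp' : dist p.1 p.2 < 1 / ((n : ℝ) + 1) := hp
    exact hp'.trans_le (one_div_le_one_div_of_le (by positivity) (by gcongr))
  · have h : V ∈ uniformity X := by
      rw [← nhdsSet_diagonal_eq_uniformity, hV.mem_nhdsSet]
      rintro ⟨x, y⟩ hxy
      obtain rfl : x = y := hxy
      exact hdiag x
    obtain ⟨ε, hε, hεV⟩ := Metric.mem_uniformity_dist.1 h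
    obtain ⟨n, hn⟩ := exists_nat_one_div_lt hε
    exact ⟨n, fun p hp => hεV (lt_trans hp hn)⟩

theorem exists_diagonal_nhds_mul [Mul X] [ContinuousMul X] {V : Set (X × X)} (hV : IsOpen V)
    (hdiag : ∀ x, (x, x) ∈ V) :
    ∃ W : Set (X × X), IsOpen W ∧ (∀ x, (x, x) ∈ W) ∧
      ∀ a b a' b', (a, b) ∈ W → (a', b') ∈ W → (a * a', b * b') ∈ V := by
  let _ := TopologicalSpace.metrizableSpaceMetric X
  have h : V ∈ uniformity X := by
    rw [← nhdsSet_diagonal_eq_uniformity, hV.mem_nhdsSet]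
    rintro ⟨x, y⟩ hxy
    obtain rfl : x = y := hxy
    exact hdiag x
  have huc : UniformContinuous fun p : X × X => p.1 * p.2 :=
    CompactSpace.uniformContinuous_of_continuous continuous_mul
  obtain ⟨ε, hε, hεV⟩ := Metric.mem_uniformity_dist.1 (mem_map.1 (huc h))
  refine ⟨{p | dist p.1 p.2 < ε}, isOpen_lt continuous_dist continuous_const,
    fun x => by simpa using hε, fun a b a' b' h1 h2 => ?_⟩
  exact hεV (a := (a, a')) (b := (b, b')) (max_lt h1 h2)

end Diagonal

/-! ### Generalized limits under averages, convolutions and limits -/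

section Limits

variable {G X : Type*} {ω : Ultrafilter ℕ} {d : ℕ → ℕ} {σ : ∀ k, G → Equiv.Perm (Fin (d k))}

theorem tendsto_one_of_le {p q : ℕ → ℝ≥0} (hp : Tendsto p (ω : Filter ℕ) (𝓝 1))
    (hpq : ∀ᶠ k in (ω : Filter ℕ), p k ≤ q k) (hq : ∀ k, q k ≤ 1) :
    Tendsto q (ω : Filter ℕ) (𝓝 1) :=
  tendsto_of_tendsto_of_tendsto_of_le_of_le' hp tendsto_const_nhds hpq (Eventually.of_forall hq)

variable [TopologicalSpace X] [MeasurableSpace X] [BorelSpace X]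

/-- The map `F` is a pointwise limit of the marginals of a sequence of measures asymptotically
supported on microstates. -/
def IsGeneralizedLimit [SMul G X] (σ : ∀ k, G → Equiv.Perm (Fin (d k)))
    (F : LoebSpace ω d → ProbabilityMeasure X) : Prop :=
  ∃ ν ∈ microstateMeasures ω σ X, ∀ᵐ z ∂(loebMeasure ω d), ∀ j : ∀ k, Fin (d k),
    LoebSpace.mk ω j = z → Tendsto (fun k => marginal (ν k) (j k)) (ω : Filter ℕ) (𝓝 (F z))

theorem IsGeneralizedLimit.congr [SMul G X] {F F' : LoebSpace ω d → ProbabilityMeasure X}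
    (hF : IsGeneralizedLimit σ F) (h : F =ᵐ[loebMeasure ω d] F') : IsGeneralizedLimit σ F' := by
  obtain ⟨ν, hν, hlim⟩ := hF
  refine ⟨ν, hν, ?_⟩
  filter_upwards [hlim, h] with z hz hFz
  rwa [← hFz]

theorem mk_mem_generalizedLimits [SMul G X] {F : LoebSpace ω d → ProbabilityMeasure X}
    (h : AEStronglyMeasurable F (loebMeasure ω d)) :
    AEEqFun.mk F h ∈ generalizedLimits ω σ X ↔ IsGeneralizedLimit σ F :=
  ⟨fun hF => IsGeneralizedLimit.congr (F := AEEqFun.mk F h) hF (AEEqFun.coeFn_mk F h),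
    fun hF => hF.congr (AEEqFun.coeFn_mk F h).symm⟩

/-- The points of `X^{d k}` that are equivariant with respect to `g`, up to `U` and `δ`. -/
def microstates [SMul G X] {n : ℕ} (σ : G → Equiv.Perm (Fin n)) (g : G) (U : Set (X × X))
    (δ : ℝ) : Set (Fin n → X) :=
  {φ | 1 - δ < unif {j | (φ (σ g j), g • φ j) ∈ U}}

theorem microstates_mono [SMul G X] {n : ℕ} (σ : G → Equiv.Perm (Fin n)) (g : G)
    {U V : Set (X × X)} {δ ε : ℝ} (hUV : U ⊆ V) (hδ : δ ≤ ε) :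
    microstates σ g U δ ⊆ microstates σ g V ε := fun φ hφ =>
  calc 1 - ε ≤ 1 - δ := by linarith
    _ < unif {j | (φ (σ g j), g • φ j) ∈ U} := hφ
    _ ≤ unif {j | (φ (σ g j), g • φ j) ∈ V} := unif_mono fun j hj => hUV hj

section Average

theorem marginal_average {n : ℕ} (m : ℕ) (p : ℕ → ProbabilityMeasure (Fin n → X)) (j : Fin n) :
    marginal (average m p) j = average m fun i => marginal (p i) j := by
  refine Subtype.ext ?_
  change (average m p : Measure (Fin n → X)).map (fun φ => φ j) = _
  rw [coe_average]
  change _ = ((m + 1 : ℕ) : ℝ≥0∞)⁻¹ • ∑ i ∈ Finset.range (m + 1),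
    (p i : Measure (Fin n → X)).map (fun φ => φ j)
  rw [Measure.map_smul, ← Measure.mapₗ_apply_of_measurable (measurable_pi_apply j), map_sum]
  simp only [Measure.mapₗ_apply_of_measurable (measurable_pi_apply j)]

theorem average_apply {M : Type*} [MeasurableSpace M] (m : ℕ) (p : ℕ → ProbabilityMeasure M)
    (s : Set M) :
    average m p s = ((m : ℝ≥0) + 1)⁻¹ * ∑ i ∈ Finset.range (m + 1), p i s := by
  refine ENNReal.coe_injective ?_
  rw [ProbabilityMeasure.ennreal_coeFn_eq_coeFn_toMeasure, coe_average, Measure.smul_apply,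
    Measure.finsetSum_apply, smul_eq_mul, ENNReal.coe_mul, ENNReal.coe_inv (by positivity),
    ENNReal.ofNNReal_finsetSum]
  simp

theorem IsGeneralizedLimit.average [SMul G X] {m : ℕ}
    {F : ℕ → LoebSpace ω d → ProbabilityMeasure X} (hF : ∀ i, IsGeneralizedLimit σ (F i)) :
    IsGeneralizedLimit σ fun z => average m fun i => F i z := by
  choose ν hν hlim using hF
  refine ⟨fun k => SoficLattice.average m fun i => ν i k, fun g U hU hdiag δ hδ => ?_, ?_⟩
  · simp only [average_apply]
    have h := (tendsto_finsetSum (Finset.range (m + 1)) fun i _ =>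
      hν i g U hU hdiag δ hδ).const_mul ((m : ℝ≥0) + 1)⁻¹
    have h1 : ((m : ℝ≥0) + 1)⁻¹ * ∑ _i ∈ Finset.range (m + 1), (1 : ℝ≥0) = 1 := by
      simp only [Finset.sum_const, Finset.card_range, nsmul_eq_mul, mul_one, Nat.cast_add,
        Nat.cast_one]
      exact inv_mul_cancel₀ (by positivity)
    rwa [h1] at h
  · filter_upwards [ae_all_iff.2 hlim] with z hz j hj
    simp only [marginal_average]
    refine ProbabilityMeasure.tendsto_iff_forall_integral_tendsto.2 fun f => ?_
    simp only [integral_average]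
    exact Tendsto.const_mul _ (tendsto_finsetSum _ fun i _ =>
      ProbabilityMeasure.tendsto_iff_forall_integral_tendsto.1 (hz i j hj) f)

end Average

section Group

variable [Group G] [Group X] [IsTopologicalGroup X] [CompactSpace X]
  [TopologicalSpace.MetrizableSpace X] [MulDistribMulAction G X]

theorem marginal_conv {n : ℕ} (μ ν : ProbabilityMeasure (Fin n → X)) (j : Fin n) :
    marginal (conv μ ν) j = conv (marginal μ j) (marginal ν j) := by
  refine Subtype.ext ?_
  change (((μ : Measure (Fin n → X)).prod (ν : Measure (Fin n → X))).map
      fun p : (Fin n → X) × (Fin n → X) => p.1 * p.2).map (fun φ => φ j) =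
    (((μ : Measure (Fin n → X)).map (fun φ => φ j)).prod
      ((ν : Measure (Fin n → X)).map (fun φ => φ j))).map fun p : X × X => p.1 * p.2
  have hj : Measurable fun φ : Fin n → X => φ j := measurable_pi_apply j
  rw [Measure.map_map hj measurable_mul, Measure.map_prod_map _ _ hj hj]
  exact (Measure.map_map (measurable_mul (M := X)) (hj.prodMap hj)).symm

/-- Independent samples lie in `s` and `t` with the product probability. Only inequalities for outer
measures are used, so the sets need not be measurable. -/
theorem mul_le_conv_apply {M : Type*} [MeasurableSpace M] [Mul M] [MeasurableMul₂ M]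
    (μ ν : ProbabilityMeasure M) {s t u : Set M} (h : ∀ x ∈ s, ∀ y ∈ t, x * y ∈ u) :
    μ s * ν t ≤ conv μ ν u := by
  rw [← ENNReal.coe_le_coe, ENNReal.coe_mul]
  simp only [ProbabilityMeasure.ennreal_coeFn_eq_coeFn_toMeasure]
  rw [← Measure.prod_prod]
  exact (measure_mono fun p hp => h _ hp.1 _ hp.2).trans
    (Measure.le_map_apply (measurable_mul (M := M)).aemeasurable u)

theorem mul_mem_microstates {n : ℕ} (σ : G → Equiv.Perm (Fin n)) (g : G) {V W : Set (X × X)}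
    (hW : ∀ a b a' b', (a, b) ∈ W → (a', b') ∈ W → (a * a', b * b') ∈ V) {δ : ℝ}
    {φ ψ : Fin n → X} (hφ : φ ∈ microstates σ g W (δ / 2)) (hψ : ψ ∈ microstates σ g W (δ / 2)) :
    φ * ψ ∈ microstates σ g V δ := by
  have h1 := unif_add_le {j | (φ (σ g j), g • φ j) ∈ W} {j | (ψ (σ g j), g • ψ j) ∈ W}
  have h2 : unif ({j | (φ (σ g j), g • φ j) ∈ W} ∩ {j | (ψ (σ g j), g • ψ j) ∈ W}) ≤
      unif {j | ((φ * ψ) (σ g j), g • (φ * ψ) j) ∈ V} := by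
    refine unif_mono fun j hj => ?_
    change ((φ * ψ) (σ g j), g • (φ * ψ) j) ∈ V
    rw [Pi.mul_apply, Pi.mul_apply, smul_mul']
    exact hW _ _ _ _ hj.1 hj.2
  have h3 : 1 - δ / 2 < unif {j | (φ (σ g j), g • φ j) ∈ W} := hφ
  have h4 : 1 - δ / 2 < unif {j | (ψ (σ g j), g • ψ j) ∈ W} := hψ
  change 1 - δ < unif {j | ((φ * ψ) (σ g j), g • (φ * ψ) j) ∈ V}
  linarith

theorem IsGeneralizedLimit.conv {F F' : LoebSpace ω d → ProbabilityMeasure X}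
    (hF : IsGeneralizedLimit σ F) (hF' : IsGeneralizedLimit σ F') :
    IsGeneralizedLimit σ fun z => conv (F z) (F' z) := by
  obtain ⟨ν, hν, hlim⟩ := hF
  obtain ⟨ν', hν', hlim'⟩ := hF'
  refine ⟨fun k => SoficLattice.conv (ν k) (ν' k), fun g U hU hdiag δ hδ => ?_, ?_⟩
  · obtain ⟨W, hW, hWdiag, hWU⟩ := exists_diagonal_nhds_mul hU hdiag
    have h := (hν g W hW hWdiag (δ / 2) (half_pos hδ)).mul
      (hν' g W hW hWdiag (δ / 2) (half_pos hδ))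
    rw [mul_one] at h
    refine tendsto_one_of_le h (Eventually.of_forall fun k => ?_)
      fun k => ProbabilityMeasure.apply_le_one _ _
    exact mul_le_conv_apply (ν k) (ν' k) fun φ hφ ψ hψ => mul_mem_microstates (σ k) g hWU hφ hψ
  · filter_upwards [hlim, hlim'] with z hz hz' j hj
    simp only [marginal_conv]
    exact (continuous_conv.tendsto (F z, F' z)).comp ((hz j hj).prodMk_nhds (hz' j hj))

/-- Automorphisms fix the identity, so the constant map `1` is an exact microstate. It supplies the
zeroth convolution power and the least element. -/
theorem isGeneralizedLimit_diracProb_one [∀ k, NeZero (d k)] :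
    IsGeneralizedLimit (ω := ω) σ fun _ => diracProb (1 : X) := by
  refine ⟨fun k => diracProb fun _ => 1, fun g U hU hdiag δ hδ => ?_,
    Eventually.of_forall fun z j _ => ?_⟩
  · refine tendsto_const_nhds.congr fun k => ?_
    refine ENNReal.coe_injective ?_
    rw [ProbabilityMeasure.ennreal_coeFn_eq_coeFn_toMeasure, ENNReal.coe_one]
    refine (Measure.dirac_apply_of_mem ?_).symm
    change 1 - δ < unif {j : Fin (d k) | ((1 : X), g • (1 : X)) ∈ U}
    have h : {j : Fin (d k) | ((1 : X), g • (1 : X)) ∈ U} = univ :=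
      eq_univ_of_forall fun j => by simpa using hdiag 1
    rw [h, unif_univ]
    linarith
  · refine tendsto_const_nhds.congr fun k => Subtype.ext ?_
    exact (Measure.map_dirac' (f := fun φ : Fin (d k) → X => φ (j k))
      (measurable_pi_apply (j k)) fun _ => 1).symm

theorem IsGeneralizedLimit.convPow [∀ k, NeZero (d k)]
    {F : LoebSpace ω d → ProbabilityMeasure X} (hF : IsGeneralizedLimit σ F) (n : ℕ) :
    IsGeneralizedLimit σ fun z => convPow (F z) n := by
  induction n with
  | zero => exact isGeneralizedLimit_diracProb_one
  | succ n ih => exact hF.conv ih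

end Group

/-- The generalized limits are closed under limits almost everywhere. -/
theorem IsGeneralizedLimit.of_tendsto [Nonempty G] [Countable G] [SMul G X] [CompactSpace X]
    [TopologicalSpace.MetrizableSpace X] [∀ k, NeZero (d k)] (hω : (ω : Filter ℕ) ≤ cofinite)
    {F : ℕ → LoebSpace ω d → ProbabilityMeasure X} {H : LoebSpace ω d → ProbabilityMeasure X}
    (hF : ∀ i, IsGeneralizedLimit σ (F i))
    (hmeas : ∀ i, AEStronglyMeasurable (F i) (loebMeasure ω d))
    (hlim : ∀ᵐ z ∂(loebMeasure ω d), Tendsto (fun n => F n z) atTop (𝓝 (H z))) :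
    IsGeneralizedLimit σ H := by
  choose ν hν hνlim using hF
  obtain ⟨U, hU, hUdiag, hUanti, hUbasis⟩ := exists_diagonal_nhds_basis (X := X)
  obtain ⟨e, he⟩ := exists_surjective_nat G
  let _ := TopologicalSpace.metrizableSpaceMetric (ProbabilityMeasure X)
  -- Thresholds strictly below `1`, so each is exceeded `ω`-almost surely, yet tending to `1`.
  let r : ℕ → ℝ≥0 := fun n => 1 - 1 / ((n : ℝ≥0) + 1)
  have hr1 : ∀ n, r n < 1 := fun n => tsub_lt_self one_pos (by positivity)
  have hr : Tendsto r atTop (𝓝 1) := by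
    have := (tendsto_const_nhds (x := (1 : ℝ≥0))).sub
      (tendsto_one_div_add_atTop_nhds_zero_nat (𝕜 := ℝ≥0))
    rwa [tsub_zero] at this
  -- Level `n` asks only for the first `n + 1` enumerated group elements, hence for finitely many
  -- conditions. As the level tends to infinity, every `g`, neighbourhood and `δ` is eventually
  -- covered.
  let E : ℕ → ℕ → Set ℕ := fun i n =>
    {k | ∀ p ≤ n, r n < ν i k (microstates (σ k) (e p) (U n) (1 / ((n : ℝ) + 1)))}
  have hE : ∀ i n, ∀ᶠ k in (ω : Filter ℕ), k ∈ E i n := fun i n =>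
    (eventually_all_finite (finite_Iic n)).2 fun p _ =>
      (hν i (e p) (U n) (hU n) (hUdiag n) _ (by positivity)).eventually (Ioi_mem_nhds (hr1 n))
  obtain ⟨N, m, hm, hNE, hlimN⟩ := exists_diagonal (f := fun i k j => marginal (ν i k) j)
    hω hνlim hmeas hlim hE
  refine ⟨fun k => ν (N k) k, fun g V hV hdiag δ hδ => ?_, hlimN⟩
  obtain ⟨p, rfl⟩ := he g
  obtain ⟨n₁, hn₁⟩ := hUbasis V hV hdiag
  obtain ⟨n₂, hn₂⟩ := exists_nat_one_div_lt hδ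
  refine tendsto_one_of_le (hr.comp hm) ?_ fun k => ProbabilityMeasure.apply_le_one _ _
  filter_upwards [hNE, hm.eventually (eventually_ge_atTop p),
    hm.eventually (eventually_ge_atTop n₁), hm.eventually (eventually_ge_atTop n₂)]
    with k hk hp h1 h2
  refine (hk p hp).le.trans (ProbabilityMeasure.apply_mono _ ?_)
  refine microstates_mono (σ k) (e p) ((hUanti h1).trans hn₁) (le_trans ?_ hn₂.le)
  exact one_div_le_one_div_of_le (by positivity) (by gcongr)

end Limits

/-! ### Joins of measurable families of closed subgroups -/

/-- A partial order with countable joins and a bounded strictly monotone real functional has joins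
of all nonempty families. -/
theorem exists_isLUB_of_strictMono {P : Type*} [PartialOrder P] {J : P → ℝ} (hJ : StrictMono J)
    (hbdd : BddAbove (range J)) (hcount : ∀ y : ℕ → P, ∃ b, IsLUB (range y) b) {s : Set P}
    (hs : s.Nonempty) : ∃ b, IsLUB s b := by
  let D : Set P := {b | ∃ y : ℕ → P, (∀ n, y n ∈ s) ∧ IsLUB (range y) b}
  have hDne : (J '' D).Nonempty := by
    obtain ⟨a, ha⟩ := hs
    obtain ⟨b, hb⟩ := hcount fun _ => a
    exact ⟨J b, b, ⟨fun _ => a, fun _ => ha, hb⟩, rfl⟩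
  have hDb : BddAbove (J '' D) := hbdd.mono (image_subset_range _ _)
  have hb : ∀ n : ℕ, ∃ b ∈ D, sSup (J '' D) - 1 / ((n : ℝ) + 1) < J b := fun n => by
    obtain ⟨_, ⟨b, hbD, rfl⟩, hlt⟩ := exists_lt_of_lt_csSup hDne
      (sub_lt_self (sSup (J '' D)) (Nat.one_div_pos_of_nat (α := ℝ) (n := n)))
    exact ⟨b, hbD, hlt⟩
  choose c hcD hc using hb
  choose y hys hy using hcD
  let w : ℕ → P := fun i => y i.unpair.1 i.unpair.2
  obtain ⟨b, hb⟩ := hcount w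
  have hcb : ∀ n, c n ≤ b := fun n => (hy n).2 (by
    rintro _ ⟨i, rfl⟩
    exact hb.1 ⟨Nat.pair n i, by simp [w]⟩)
  have hsup : sSup (J '' D) ≤ J b := by
    refine le_of_forall_pos_le_add fun ε hε => ?_
    obtain ⟨n, hn⟩ := exists_nat_one_div_lt hε
    have := hJ.monotone (hcb n)
    linarith [hc n]
  refine ⟨b, fun a ha => ?_, fun u hu => hb.2 ?_⟩
  -- Adjoining `a` to the maximizing sequence gives another countable join above `b`. Its value
  -- cannot exceed the supremum, which `b` attains, so strict monotonicity forces equality.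
  · obtain ⟨b', hb'⟩ := hcount fun i => Nat.casesOn i a w
    have hle : b ≤ b' := hb.2 (by
      rintro _ ⟨i, rfl⟩
      exact hb'.1 ⟨i + 1, rfl⟩)
    have hb'D : b' ∈ D := ⟨_, fun i => by
      cases i with
      | zero => exact ha
      | succ i => exact hys _ _, hb'⟩
    have heq : b = b' := by
      by_contra hne
      exact absurd (hJ (lt_of_le_of_ne hle hne))
        (not_lt.2 ((le_csSup hDb ⟨b', hb'D, rfl⟩).trans hsup))
    rw [heq]
    exact hb'.1 ⟨0, rfl⟩
  · rintro _ ⟨i, rfl⟩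
    exact hu (hys _ _)

/-! ### Strictly monotone functionals on families of subgroups -/

section Functional

variable {X : Type*} [Group X] [TopologicalSpace X] [IsTopologicalGroup X] [CompactSpace X]
  [TopologicalSpace.MetrizableSpace X] [MeasurableSpace X] [BorelSpace X]

/-- The functional is minus the Haar average of the distance to `Y`. It is strict because distance
functions are continuous and Haar measure has full support: equal averages for nested subgroups
force equal distance functions, hence equal closed sets. -/
theorem exists_strictMono_continuous_of_metricSpace {X : Type*} [Group X] [MetricSpace X]
    [IsTopologicalGroup X] [CompactSpace X] [MeasurableSpace X] [BorelSpace X] :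
    ∃ Φ : ClosedSubgroup X → ℝ, Continuous Φ ∧ StrictMono Φ := by
  let m : Measure X := Measure.haarMeasure ⊤
  have hcont : Continuous fun p : ClosedSubgroup X × X => Metric.infDist p.2 (p.1 : Set X) := by
    have h1 : Continuous fun p : X × TopologicalSpace.NonemptyCompacts X =>
      Metric.infDist p.1 (p.2 : Set X) := Metric.lipschitz_infDist.continuous
    have h2 : Continuous fun p : ClosedSubgroup X × X => (p.2, toNonemptyCompacts p.1) :=
      continuous_snd.prodMk (isEmbedding_toNonemptyCompacts.continuous.comp continuous_fst)
    have h3 := h1.comp h2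
    simpa only [Function.comp_def, coe_toNonemptyCompacts] using h3
  have hint : ∀ Y : ClosedSubgroup X, Integrable (fun x => Metric.infDist x (Y : Set X)) m :=
    fun Y => (BoundedContinuousFunction.mkOfCompact
      ⟨_, Metric.continuous_infDist_pt (Y : Set X)⟩).integrable _
  refine ⟨fun Y => -∫ x, Metric.infDist x (Y : Set X) ∂m, ?_, fun Y Y' h => neg_lt_neg ?_⟩
  · have := continuous_parametric_integral_of_continuous (μ := m)
      (f := fun (Y : ClosedSubgroup X) x => Metric.infDist x (Y : Set X)) hcont isCompact_univ
    simp only [setIntegral_univ] at this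
    exact this.neg
  · have hle : ∀ x, Metric.infDist x (Y' : Set X) ≤ Metric.infDist x (Y : Set X) := fun x =>
      Metric.infDist_le_infDist_of_subset h.le ⟨1, Y.one_mem'⟩
    refine lt_of_le_of_ne (integral_mono (hint Y') (hint Y) hle) fun heq => h.not_ge ?_
    have hae := (integral_eq_iff_of_ae_le (hint Y') (hint Y) (Eventually.of_forall hle)).1 heq
    have hfun := Continuous.ae_eq_iff_eq m (Metric.continuous_infDist_pt _)
      (Metric.continuous_infDist_pt _) |>.1 hae
    intro x hx
    have hx0 := congrFun hfun x
    simp only [Metric.infDist_zero_of_mem (s := (Y' : Set X)) hx] at hx0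
    exact (Y.isClosed'.mem_iff_infDist_zero ⟨1, Y.one_mem'⟩).2 hx0.symm

/-- There is a strictly monotone continuous real function on the space of closed subgroups. -/
theorem exists_strictMono_continuous :
    ∃ Φ : ClosedSubgroup X → ℝ, Continuous Φ ∧ StrictMono Φ := by
  let _ := TopologicalSpace.metrizableSpaceMetric X
  exact exists_strictMono_continuous_of_metricSpace

/-- There is a bounded strictly monotone real functional on measurable families of closed
subgroups. -/
theorem exists_strictMono_functional {Ω : Type*} [MeasurableSpace Ω] (P : Measure Ω)
    [IsProbabilityMeasure P] :
    ∃ J : (Ω →ₘ[P] ClosedSubgroup X) → ℝ, StrictMono J ∧ BddAbove (range J) := by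
  obtain ⟨Φ, hΦ, hmono⟩ := exists_strictMono_continuous (X := X)
  let Ψ := BoundedContinuousFunction.mkOfCompact ⟨Φ, hΦ⟩
  have hint : ∀ Y : Ω →ₘ[P] ClosedSubgroup X, Integrable (fun z => Φ (Y z)) P := fun Y =>
    Integrable.of_bound (hΦ.comp_aestronglyMeasurable Y.aestronglyMeasurable) ‖Ψ‖
      (Eventually.of_forall fun z => Ψ.norm_coe_le_norm (Y z))
  refine ⟨fun Y => ∫ z, Φ (Y z) ∂P, fun Y Y' h => ?_, ‖Ψ‖, ?_⟩
  · have hle : (fun z => Φ (Y z)) ≤ᵐ[P] fun z => Φ (Y' z) := by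
      filter_upwards [AEEqFun.coeFn_le.2 h.le] with z hz
      exact hmono.monotone hz
    refine lt_of_le_of_ne (integral_mono_ae (hint Y) (hint Y') hle) fun heq => h.ne ?_
    refine AEEqFun.ext ?_
    filter_upwards [AEEqFun.coeFn_le.2 h.le,
      (integral_eq_iff_of_ae_le (hint Y) (hint Y') hle).1 heq] with z hz1 hz2
    by_contra hne
    exact (hmono (lt_of_le_of_ne hz1 hne)).ne hz2
  · rintro _ ⟨Y, rfl⟩
    have := norm_integral_le_of_norm_le_const (μ := P) (f := fun z => Φ (Y z)) (C := ‖Ψ‖)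
      (Eventually.of_forall fun z => Ψ.norm_coe_le_norm (Y z))
    rw [probReal_univ, mul_one] at this
    exact (le_abs_self _).trans this

end Functional

/-! ### Measurability of generated subgroups and countable joins -/

section Measurability

variable {X : Type*} [Group X] [TopologicalSpace X] [IsTopologicalGroup X] [CompactSpace X]
  [TopologicalSpace.MetrizableSpace X] [MeasurableSpace X] [BorelSpace X]
  {Ω : Type*} [MeasurableSpace Ω] {P : Measure Ω}

theorem continuous_convPow (n : ℕ) :
    Continuous fun μ : ProbabilityMeasure X => convPow μ n := by
  induction n with
  | zero => exact continuous_const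
  | succ n ih => exact continuous_conv.comp (continuous_id.prodMk ih)

theorem aestronglyMeasurable_average_convPow {F : Ω → ProbabilityMeasure X}
    (hF : AEStronglyMeasurable F P) (n : ℕ) :
    AEStronglyMeasurable (fun z => average n (convPow (F z))) P :=
  (continuous_average n continuous_convPow).comp_aestronglyMeasurable hF

/-- By Kawada–Itô the Haar measures are pointwise limits of continuous functions of `F z`; the
embedding `haarProb` transfers measurability back to the subgroups. -/
theorem aestronglyMeasurable_closedSubgroupGen_support {F : Ω → ProbabilityMeasure X}
    (hF : AEStronglyMeasurable F P) :
    AEStronglyMeasurable (fun z => closedSubgroupGen (F z : Measure X).support) P :=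
  isEmbedding_haarProb.aestronglyMeasurable_comp_iff.1
    (aestronglyMeasurable_of_tendsto_ae atTop (aestronglyMeasurable_average_convPow hF)
      (Eventually.of_forall fun z => tendsto_average_convPow (F z)))

/-- The average of the Haar measures of two closed subgroups. -/
def haarPair (Y₁ Y₂ : ClosedSubgroup X) : ProbabilityMeasure X :=
  average 1 fun i => if i = 0 then haarProb Y₁ else haarProb Y₂

theorem support_haarPair (Y₁ Y₂ : ClosedSubgroup X) :
    (haarPair Y₁ Y₂ : Measure X).support = (Y₁ : Set X) ∪ Y₂ := by
  have h : (haarPair Y₁ Y₂ : Measure X) =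
      ((1 + 1 : ℕ) : ℝ≥0∞)⁻¹ • ((haarProb Y₁ : Measure X) + (haarProb Y₂ : Measure X)) := by
    rw [haarPair, coe_average, Finset.sum_range_succ, Finset.sum_range_one]
    simp
  rw [← support_haarProb Y₁, ← support_haarProb Y₂, ← Measure.support_add, h]
  ext x
  simp only [Measure.mem_support_iff_forall, Measure.smul_apply, smul_eq_mul]
  refine forall₂_congr fun U _ => ?_
  rw [pos_iff_ne_zero, pos_iff_ne_zero, mul_ne_zero_iff]
  exact and_iff_right (ENNReal.inv_ne_zero.2 (ENNReal.natCast_ne_top _))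

theorem aestronglyMeasurable_haarPair {Y₁ Y₂ : Ω → ClosedSubgroup X}
    (h₁ : AEStronglyMeasurable Y₁ P) (h₂ : AEStronglyMeasurable Y₂ P) :
    AEStronglyMeasurable (fun z => haarPair (Y₁ z) (Y₂ z)) P := by
  have hc : Continuous fun p : ClosedSubgroup X × ClosedSubgroup X => haarPair p.1 p.2 := by
    refine continuous_average 1 (p := fun i (p : ClosedSubgroup X × ClosedSubgroup X) =>
      if i = 0 then haarProb p.1 else haarProb p.2) fun i => ?_
    by_cases hi : i = 0
    · simpa only [hi, if_true, Function.comp_def] using continuous_haarProb.comp continuous_fst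
    · simpa only [hi, if_false, Function.comp_def] using continuous_haarProb.comp continuous_snd
  have h := hc.comp_aestronglyMeasurable (h₁.prodMk h₂)
  exact h

theorem aestronglyMeasurable_join {Y₁ Y₂ : Ω → ClosedSubgroup X}
    (h₁ : AEStronglyMeasurable Y₁ P) (h₂ : AEStronglyMeasurable Y₂ P) :
    AEStronglyMeasurable (fun z => closedSubgroupGen ((Y₁ z : Set X) ∪ (Y₂ z : Set X))) P := by
  simpa only [support_haarPair] using
    aestronglyMeasurable_closedSubgroupGen_support (aestronglyMeasurable_haarPair h₁ h₂)

/-- The joins of the first `n + 1` terms of a sequence of closed subgroups. -/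
def partialJoin (Y : ℕ → ClosedSubgroup X) : ℕ → ClosedSubgroup X
  | 0 => Y 0
  | n + 1 => closedSubgroupGen ((partialJoin Y n : Set X) ∪ (Y (n + 1) : Set X))

theorem partialJoin_monotone (Y : ℕ → ClosedSubgroup X) : Monotone (partialJoin Y) :=
  monotone_nat_of_le_succ fun _ => subset_union_left.trans (subset_closedSubgroupGen _)

theorem le_partialJoin (Y : ℕ → ClosedSubgroup X) (n : ℕ) : Y n ≤ partialJoin Y n := by
  cases n with
  | zero => exact le_rfl
  | succ n => exact subset_union_right.trans (subset_closedSubgroupGen _)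

theorem partialJoin_le {Y : ℕ → ClosedSubgroup X} {B : ClosedSubgroup X} (h : ∀ n, Y n ≤ B)
    (n : ℕ) : partialJoin Y n ≤ B := by
  induction n with
  | zero => exact h 0
  | succ n ih => exact closedSubgroupGen_le (union_subset ih (h (n + 1)))

theorem aestronglyMeasurable_partialJoin {Y : ℕ → Ω → ClosedSubgroup X}
    (h : ∀ n, AEStronglyMeasurable (Y n) P) (n : ℕ) :
    AEStronglyMeasurable (fun z => partialJoin (fun i => Y i z) n) P := by
  induction n with
  | zero => exact h 0
  | succ n ih => exact aestronglyMeasurable_join ih (h (n + 1))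

/-- The join of a sequence of closed subgroups. -/
def countableJoin (Y : ℕ → ClosedSubgroup X) : ClosedSubgroup X :=
  closedSubgroupGen (⋃ n, (partialJoin Y n : Set X))

theorem le_countableJoin (Y : ℕ → ClosedSubgroup X) (n : ℕ) : Y n ≤ countableJoin Y := fun _ hx =>
  subset_closedSubgroupGen _ (mem_iUnion.2 ⟨n, le_partialJoin Y n hx⟩)

theorem countableJoin_le {Y : ℕ → ClosedSubgroup X} {B : ClosedSubgroup X} (h : ∀ n, Y n ≤ B) :
    countableJoin Y ≤ B :=
  closedSubgroupGen_le (iUnion_subset fun n => partialJoin_le h n)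

theorem aestronglyMeasurable_countableJoin {Y : ℕ → Ω → ClosedSubgroup X}
    (h : ∀ n, AEStronglyMeasurable (Y n) P) :
    AEStronglyMeasurable (fun z => countableJoin fun i => Y i z) P :=
  isEmbedding_haarProb.aestronglyMeasurable_comp_iff.1
    (aestronglyMeasurable_of_tendsto_ae atTop
      (fun n => continuous_haarProb.comp_aestronglyMeasurable (aestronglyMeasurable_partialJoin h n))
      (Eventually.of_forall fun _ => tendsto_haarProb_of_monotone (partialJoin_monotone _)))

/-- Countability is what allows the almost everywhere inclusions to hold simultaneously, so that the
join can be taken pointwise. -/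
theorem isLUB_countableJoin (Y : ℕ → (Ω →ₘ[P] ClosedSubgroup X)) :
    IsLUB (range Y) (AEEqFun.mk (fun z => countableJoin fun i => Y i z)
      (aestronglyMeasurable_countableJoin fun i => (Y i).aestronglyMeasurable)) := by
  have hmk := AEEqFun.coeFn_mk (μ := P) _
    (aestronglyMeasurable_countableJoin fun i => (Y i).aestronglyMeasurable)
  constructor
  · rintro _ ⟨n, rfl⟩
    refine AEEqFun.coeFn_le.1 ?_
    filter_upwards [hmk] with z hz
    rw [hz]
    exact le_countableJoin (fun i => Y i z) n
  · intro B hB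
    refine AEEqFun.coeFn_le.1 ?_
    filter_upwards [hmk, ae_all_iff.2 fun n => AEEqFun.coeFn_le.2 (hB ⟨n, rfl⟩)] with z hz hBz
    rw [hz]
    exact countableJoin_le hBz

theorem isBot_mk_diracProb_one :
    IsBot (AEEqFun.mk (fun _ => closedSubgroupGen ((diracProb (1 : X) : Measure X)).support)
      (aestronglyMeasurable_closedSubgroupGen_support (P := P) aestronglyMeasurable_const)) := by
  intro Y
  refine AEEqFun.coeFn_le.1 ?_
  filter_upwards [AEEqFun.coeFn_mk _ (aestronglyMeasurable_closedSubgroupGen_support (P := P)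
    (aestronglyMeasurable_const (b := diracProb (1 : X))))] with z hz
  rw [hz]
  refine closedSubgroupGen_le (Measure.support_subset_of_isClosed (Y z).isClosed' ?_)
  exact (ae_dirac_iff (p := (· ∈ (Y z : Set X))) (Y z).isClosed'.measurableSet).2 (Y z).one_mem'

end Measurability

/-! ### Joins of limit subgroups -/

section LimitSubgroups

variable {G X : Type*} [Group G] [Countable G] {ω : Ultrafilter ℕ} {d : ℕ → ℕ} [∀ k, NeZero (d k)]
  {σ : ∀ k, G → Equiv.Perm (Fin (d k))}
  [Group X] [TopologicalSpace X] [IsTopologicalGroup X] [CompactSpace X]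
  [TopologicalSpace.MetrizableSpace X] [MeasurableSpace X] [BorelSpace X]
  [MulDistribMulAction G X]

theorem mem_limitSubgroups {Y : Meas ω d (ClosedSubgroup X)} :
    Y ∈ limitSubgroups ω σ X ↔ IsGeneralizedLimit σ fun z => haarProb (Y z) :=
  ⟨fun ⟨_, h⟩ => (mk_mem_generalizedLimits _).1 h, fun h =>
    ⟨continuous_haarProb.comp_aestronglyMeasurable Y.aestronglyMeasurable,
      (mk_mem_generalizedLimits _).2 h⟩⟩

theorem mk_mem_limitSubgroups {Y : LoebSpace ω d → ClosedSubgroup X}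
    (h : AEStronglyMeasurable Y (loebMeasure ω d)) :
    AEEqFun.mk Y h ∈ limitSubgroups ω σ X ↔ IsGeneralizedLimit σ fun z => haarProb (Y z) := by
  have hmk : (fun z => haarProb (AEEqFun.mk Y h z)) =ᵐ[loebMeasure ω d]
      fun z => haarProb (Y z) := by
    filter_upwards [AEEqFun.coeFn_mk Y h] with z hz
    rw [hz]
  rw [mem_limitSubgroups]
  exact ⟨fun H => H.congr hmk, fun H => H.congr hmk.symm⟩

theorem IsGeneralizedLimit.haarProb_support (hω : (ω : Filter ℕ) ≤ cofinite)
    {F : LoebSpace ω d → ProbabilityMeasure X} (hF : IsGeneralizedLimit σ F)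
    (hmeas : AEStronglyMeasurable F (loebMeasure ω d)) :
    IsGeneralizedLimit σ fun z => haarProb (closedSubgroupGen (F z : Measure X).support) :=
  IsGeneralizedLimit.of_tendsto hω (fun _ => IsGeneralizedLimit.average fun i => hF.convPow i)
    (aestronglyMeasurable_average_convPow hmeas)
    (Eventually.of_forall fun z => tendsto_average_convPow (F z))

theorem IsGeneralizedLimit.haarProb_join (hω : (ω : Filter ℕ) ≤ cofinite)
    {Y₁ Y₂ : LoebSpace ω d → ClosedSubgroup X}
    (h₁ : IsGeneralizedLimit σ fun z => haarProb (Y₁ z))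
    (h₂ : IsGeneralizedLimit σ fun z => haarProb (Y₂ z))
    (hm₁ : AEStronglyMeasurable Y₁ (loebMeasure ω d))
    (hm₂ : AEStronglyMeasurable Y₂ (loebMeasure ω d)) :
    IsGeneralizedLimit σ fun z =>
      haarProb (closedSubgroupGen ((Y₁ z : Set X) ∪ (Y₂ z : Set X))) := by
  have h : IsGeneralizedLimit σ fun z => haarPair (Y₁ z) (Y₂ z) := by
    refine IsGeneralizedLimit.average (F := fun i z =>
      if i = 0 then haarProb (Y₁ z) else haarProb (Y₂ z)) fun i => ?_
    by_cases hi : i = 0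
    · simpa only [hi, if_true] using h₁
    · simpa only [hi, if_false] using h₂
  simpa only [support_haarPair] using h.haarProb_support hω (aestronglyMeasurable_haarPair hm₁ hm₂)

theorem IsGeneralizedLimit.haarProb_countableJoin (hω : (ω : Filter ℕ) ≤ cofinite)
    {Y : ℕ → LoebSpace ω d → ClosedSubgroup X}
    (h : ∀ n, IsGeneralizedLimit σ fun z => haarProb (Y n z))
    (hm : ∀ n, AEStronglyMeasurable (Y n) (loebMeasure ω d)) :
    IsGeneralizedLimit σ fun z => haarProb (countableJoin fun i => Y i z) := by
  refine IsGeneralizedLimit.of_tendsto hω (F := fun n z => haarProb (partialJoin (fun i => Y i z) n))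
    (fun n => ?_)
    (fun n => continuous_haarProb.comp_aestronglyMeasurable (aestronglyMeasurable_partialJoin hm n))
    (Eventually.of_forall fun _ => tendsto_haarProb_of_monotone (partialJoin_monotone _))
  induction n with
  | zero => exact h 0
  | succ n ih =>
    exact ih.haarProb_join hω (h (n + 1)) (aestronglyMeasurable_partialJoin hm n) (hm (n + 1))

theorem isCompleteJoinLattice_meas (hω : (ω : Filter ℕ) ≤ cofinite) :
    IsCompleteJoinLattice (Meas ω d (ClosedSubgroup X)) := by
  intro s
  have := isProbabilityMeasure_loebMeasure (d := d) hω
  rcases s.eq_empty_or_nonempty with rfl | hs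
  · exact ⟨_, isLUB_empty_iff.2 isBot_mk_diracProb_one⟩
  · obtain ⟨J, hJ, hbdd⟩ := exists_strictMono_functional (X := X) (loebMeasure ω d)
    exact exists_isLUB_of_strictMono hJ hbdd (fun Y => ⟨_, isLUB_countableJoin Y⟩) hs

theorem isCompleteJoinLattice_limitSubgroups (hω : (ω : Filter ℕ) ≤ cofinite) :
    IsCompleteJoinLattice (limitSubgroups ω σ X) := by
  intro s
  have := isProbabilityMeasure_loebMeasure (d := d) hω
  rcases s.eq_empty_or_nonempty with rfl | hs
  · have hbot := (mk_mem_limitSubgroups (σ := σ) (aestronglyMeasurable_closedSubgroupGen_support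
      (P := loebMeasure ω d) (aestronglyMeasurable_const (b := diracProb (1 : X))))).2
      (isGeneralizedLimit_diracProb_one.haarProb_support hω aestronglyMeasurable_const)
    exact ⟨⟨_, hbot⟩, isLUB_empty_iff.2 fun Y => isBot_mk_diracProb_one Y.1⟩
  · obtain ⟨J, hJ, hbdd⟩ := exists_strictMono_functional (X := X) (loebMeasure ω d)
    refine exists_isLUB_of_strictMono (J := fun Y : limitSubgroups ω σ X => J Y.1)
      (fun _ _ h => hJ h) (hbdd.mono ?_) (fun Y => ?_) hs
    · rintro _ ⟨Y, rfl⟩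
      exact ⟨Y.1, rfl⟩
    -- The join taken among all measurable families is itself a limit subgroup, so it is also the
    -- least upper bound in the smaller order.
    · have hLUB := isLUB_countableJoin fun n => (Y n).1
      refine ⟨⟨_, (mk_mem_limitSubgroups (aestronglyMeasurable_countableJoin fun n =>
        (Y n).1.aestronglyMeasurable)).2 (IsGeneralizedLimit.haarProb_countableJoin hω
          (fun n => mem_limitSubgroups.1 (Y n).2) fun n => (Y n).1.aestronglyMeasurable)⟩, ?_, ?_⟩
      · rintro _ ⟨n, rfl⟩
        exact hLUB.1 ⟨n, rfl⟩
      · intro B hB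
        refine hLUB.2 ?_
        rintro _ ⟨n, rfl⟩
        exact hB ⟨n, rfl⟩

end LimitSubgroups

end

end SoficLattice

open SoficLattice
theorem theoremT {G X : Type*} [Group G] [Countable G]
    (d : ℕ → ℕ) [∀ k, NeZero (d k)] (σ : ∀ k, G → Equiv.Perm (Fin (d k)))
    (hσ : IsSoficApproximation σ)
    (ω : Ultrafilter ℕ) (hω : (ω : Filter ℕ) ≤ Filter.cofinite)
    [Group X] [TopologicalSpace X] [IsTopologicalGroup X] [CompactSpace X]
    [TopologicalSpace.MetrizableSpace X] [MeasurableSpace X] [BorelSpace X]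
    [MulDistribMulAction G X] [ContinuousConstSMul G X] :
    (∀ μ ∈ generalizedLimits ω σ X,
      ∃ h : AEStronglyMeasurable (fun z => closedSubgroupGen (μ z : Measure X).support)
          (loebMeasure ω d),
        AEEqFun.mk (fun z => closedSubgroupGen (μ z : Measure X).support) h
          ∈ limitSubgroups ω σ X) ∧
    (∀ Y₁ ∈ limitSubgroups ω σ X, ∀ Y₂ ∈ limitSubgroups ω σ X,
      ∃ h : AEStronglyMeasurable (fun z => closedSubgroupGen ((Y₁ z : Set X) ∪ (Y₂ z : Set X)))
          (loebMeasure ω d),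
        AEEqFun.mk (fun z => closedSubgroupGen ((Y₁ z : Set X) ∪ (Y₂ z : Set X))) h
          ∈ limitSubgroups ω σ X) ∧
    IsCompleteJoinLattice (Meas ω d (ClosedSubgroup X)) ∧
    IsCompleteJoinLattice (limitSubgroups ω σ X) := by
  refine ⟨fun μ hμ => ?_, fun Y₁ h₁ Y₂ h₂ => ?_, isCompleteJoinLattice_meas hω,
    isCompleteJoinLattice_limitSubgroups hω⟩
  · have hμ' : IsGeneralizedLimit σ fun z => μ z := hμ
    exact ⟨aestronglyMeasurable_closedSubgroupGen_support μ.aestronglyMeasurable,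
      (mk_mem_limitSubgroups _).2 (hμ'.haarProb_support hω μ.aestronglyMeasurable)⟩
  · exact ⟨aestronglyMeasurable_join Y₁.aestronglyMeasurable Y₂.aestronglyMeasurable,
      (mk_mem_limitSubgroups _).2 ((mem_limitSubgroups.1 h₁).haarProb_join hω
        (mem_limitSubgroups.1 h₂) Y₁.aestronglyMeasurable Y₂.aestronglyMeasurable)⟩
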